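/- For a permutation $\pi=\pi_1\pi_2\cdots\pi_n$ of $\{1,\dots,n\}$ let $\ell(\pi)$ be its length, i.e. the minimal $k$ such that $\pi=s_{i_1}\cdots s_{i_k}$ with $s_i=(i\;\,i+1)$, $1\le i\le n-1$; the words $i_1\cdots i_k$ of this minimal length are the reduced words of $\pi$, and $R(\pi)$ is the set of them. A commutation move switches two adjacent letters $j,k$ with $|j-k|>1$; a long braid move exchanges consecutive letters $j(j+1)j$ and $(j+1)j(j+1)$. Let $G_\pi$ be the graph on $R(\pi)$ whose edges are the commutation moves and the long braid moves, let $C_\pi$ be $G_\pi$ contracted along the commutation edges (its vertices are the commutation classes, its edges come from long braid moves), and let $B_\pi$ be $G_\pi$ contracted along the long braid edges. For permutations $\sigma$ of $\{1,\dots,k\}$ and $\pi_{(1)},\dots,\pi_{(k)}$ of any sizes $\ge 0$, the inflation $\sigma[\pi_{(1)},\dots,\pi_{(k)}]$ is $\sigma$ with each letter $\sigma_i$ replaced by a block of consecutive positions, with consecutive values, order isomorphic to $\pi_{(i)}$. A permutation avoids $231$ if it has no subsequence order isomorphic to $231$. **Theorem.** Let $n\ge 1$, let $\pi$ be a $231$-avoiding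 permutation of $\{1,\dots,n\}$, and let $m$ be the position with $\pi_m=n$. Then $\pi=12[\pi',21[1,\pi'']]$ for some $231$-avoiding permutations $\pi'$ of size $m-1$ and $\pi''$ of size $n-m$. Moreover, for every such decomposition of $\pi$, with $\pi'$ of size $m-1$ and $\pi''$ of size $n-m$, the graphs $G_\pi$, $C_\pi$, $B_\pi$ are connected and 1. $\operatorname{diam}(G_\pi)=\operatorname{diam}(G_{\pi'})+\operatorname{diam}(G_{\pi''})+(n-m)\bigl(\ell(\pi')+\ell(\pi'')\bigr)+\ell(\pi'')\bigl(\ell(\pi')-1\bigr)$; 2. $\operatorname{diam}(C_\pi)=\operatorname{diam}(C_{\pi'})+\operatorname{diam}(C_{\pi''})+\ell(\pi'')$; 3. $\operatorname{diam}(B_\pi)=\operatorname{diam}(B_{\pi'})+\operatorname{diam}(B_{\pi''})+(n-m)\bigl(\ell(\pi')+\ell(\pi'')\bigr)+\ell(\pi'')\bigl(\ell(\pi')-2\bigr)$. -/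

import Mathlib

/-! Permutations of `{0, …, n - 1}` are Mathlib's `Equiv.Perm (Fin n)`; the one-line notation of `π`
is `π 0, π 1, …, π (n - 1)`. Positions, values and letters of words are therefore numbered from
`0` instead of `1`. -/

namespace PermGraph

/-! ### Patterns -/

/-- `π` contains the pattern `σ`: some subsequence of the one-line notation of `π` is order
isomorphic to that of `σ`. -/
def Contains {n k : ℕ} (π : Equiv.Perm (Fin n)) (σ : Equiv.Perm (Fin k)) : Prop :=
  ∃ f : Fin k ↪o Fin n, ∀ i j : Fin k, π (f i) ≤ π (f j) ↔ σ i ≤ σ j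

/-- `π` avoids the pattern `σ`. -/
def Avoids {n k : ℕ} (π : Equiv.Perm (Fin n)) (σ : Equiv.Perm (Fin k)) : Prop :=
  ¬ Contains π σ

/-- The permutation `231` of three letters. -/
def perm231 : Equiv.Perm (Fin 3) where
  toFun := ![1, 2, 0]
  invFun := ![2, 0, 1]
  left_inv := by decide
  right_inv := by decide

/-! ### Inflations -/

/-- Permutations of arbitrary finite size, including the empty permutation; `p.1` is the size. -/
abbrev SizedPerm : Type := Σ n : ℕ, Equiv.Perm (Fin n)

/-- The inflation `σ[p 0, …, p (k - 1)]`: every letter `σ i` of `σ` is replaced by a block that is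
order isomorphic to `p i`. A position of the inflation is a pair (block `i`, position `j` in
the block), and such pairs are arranged lexicographically; the value there is the pair
(`σ i`, `p i j`), and the pairs (value of `σ`, value in the block) are again arranged
lexicographically. -/
def inflation {k : ℕ} (σ : Equiv.Perm (Fin k)) (p : Fin k → SizedPerm) :
    SizedPerm :=
  ⟨∑ i, (p i).1,
    (finSigmaFinEquiv (n := fun i => (p i).1)).symm.trans <|
      (Equiv.sigmaCongrRight fun i => (p i).2).trans <|
        (Equiv.sigmaCongrLeft' (β := fun i => Fin (p i).1) σ).trans <|
          (finSigmaFinEquiv (n := fun c => (p (σ.symm c)).1)).trans <|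
            finCongr (Equiv.sum_comp σ.symm fun i => (p i).1)⟩

/-- The permutation `12`. -/
def perm12 : Equiv.Perm (Fin 2) := 1

/-- The permutation `21`. -/
def perm21 : Equiv.Perm (Fin 2) := Equiv.swap 0 1

/-- The permutation `1` of a single letter, as a permutation with a size. -/
def single : SizedPerm := ⟨1, 1⟩

/-! ### Reduced words -/

/-- The simple reflection that interchanges `i` and `i + 1` (only used for `i + 1 < n`). -/
def simpleReflection (n i : ℕ) : Equiv.Perm (Fin n) :=
  if h : i + 1 < n then Equiv.swap ⟨i, Nat.lt_of_succ_lt h⟩ ⟨i + 1, h⟩ else 1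

/-- `w` is a word for `π`: its letters are indices of simple reflections, and the product of
these reflections, in the order of the word, is `π`. -/
def IsWord {n : ℕ} (π : Equiv.Perm (Fin n)) (w : List ℕ) : Prop :=
  (∀ i ∈ w, i + 1 < n) ∧ (w.map (simpleReflection n)).prod = π

/-- `w` is a reduced word for `π`: a word for `π` of minimal length. -/
def IsReducedWord {n : ℕ} (π : Equiv.Perm (Fin n)) (w : List ℕ) : Prop :=
  IsWord π w ∧ ∀ v, IsWord π v → w.length ≤ v.length

/-- The set `R(π)` of reduced words of `π`, as a type. -/
abbrev ReducedWord {n : ℕ} (π : Equiv.Perm (Fin n)) : Type :=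
  {w : List ℕ // IsReducedWord π w}

/-- The length `ℓ(π)`: the minimal length of a word for `π`. -/
noncomputable def length {n : ℕ} (π : Equiv.Perm (Fin n)) : ℕ :=
  sInf {k | ∃ w, IsWord π w ∧ w.length = k}

/-! ### Moves and graphs -/

/-- A commutation move: two adjacent letters `j`, `k` with `|j - k| > 1` are switched. -/
def CommutationMove (u v : List ℕ) : Prop :=
  ∃ (x y : List ℕ) (j k : ℕ), (j + 1 < k ∨ k + 1 < j) ∧
    u = x ++ [j, k] ++ y ∧ v = x ++ [k, j] ++ y

/-- A long braid move: consecutive letters `j (j+1) j` and `(j+1) j (j+1)` are exchanged. -/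
def LongBraidMove (u v : List ℕ) : Prop :=
  ∃ (x y : List ℕ) (j : ℕ),
    (u = x ++ [j, j + 1, j] ++ y ∧ v = x ++ [j + 1, j, j + 1] ++ y) ∨
    (u = x ++ [j + 1, j, j + 1] ++ y ∧ v = x ++ [j, j + 1, j] ++ y)

/-- The graph `G_π` on the reduced words of `π`, whose edges are the commutation moves and the
long braid moves. (A move never fixes a word, so `u ≠ v` only restates that there are no
loops.) -/
def G {n : ℕ} (π : Equiv.Perm (Fin n)) : SimpleGraph (ReducedWord π) where
  Adj u v := u ≠ v ∧
    (CommutationMove u.1 v.1 ∨ CommutationMove v.1 u.1 ∨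
      LongBraidMove u.1 v.1 ∨ LongBraidMove v.1 u.1)
  symm := ⟨fun _ _ h => ⟨h.1.symm, by tauto⟩⟩
  loopless := ⟨fun _ h => h.1 rfl⟩

/-- Contraction: the vertices are the classes of the equivalence relation generated by `c`, and
two different classes are adjacent when `e` relates a member of one to a member of the other. -/
def contraction {V : Type} (c e : V → V → Prop) : SimpleGraph (Quot c) where
  Adj A B := A ≠ B ∧
    ∃ u v : V, Quot.mk c u = A ∧ Quot.mk c v = B ∧ (e u v ∨ e v u)
  symm := ⟨fun _ _ ⟨h, u, v, hu, hv, he⟩ => ⟨h.symm, v, u, hv, hu, he.symm⟩⟩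
  loopless := ⟨fun _ h => h.1 rfl⟩

/-- The graph `C_π`: `G_π` contracted along the commutation edges, so that the vertices are the
commutation classes and the edges come from long braid moves. -/
def C {n : ℕ} (π : Equiv.Perm (Fin n)) :
    SimpleGraph (Quot fun u v : ReducedWord π => CommutationMove u.1 v.1) :=
  contraction _ fun u v => LongBraidMove u.1 v.1

/-- The graph `B_π`: `G_π` contracted along the long braid edges, so that the vertices are the
braid classes and the edges come from commutation moves. -/
def B {n : ℕ} (π : Equiv.Perm (Fin n)) :
    SimpleGraph (Quot fun u v : ReducedWord π => LongBraidMove u.1 v.1) :=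
  contraction _ fun u v => CommutationMove u.1 v.1

end PermGraph

/-! Charge `α` for a long braid move and `β` for a commutation move. The three diameters are those
of the set of reduced words for the costs `(α, β) = (1, 1), (1, 0), (0, 1)`, so it is enough to
follow the diameter for arbitrary costs.

A permutation `12[π', 21[1, π'']]` is the direct sum `π' ⊕ π''` times a descending cycle that brings
the largest entry to its position, and each of the two steps adds a constant to the diameter for
the same reason. Every reduced word projects to a reduced word of the smaller object and lies on a
shortest path between two lifts of its projection: all letters of `π'` before or after all letters
of `π''` in the first step, and the cycle at the end or at the beginning of the word in the second.
Projecting does not increase the cost, and the distance between the two families of lifts is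
bounded below by weights that each move changes by a controlled amount: the number of inversions
between the two kinds of letters in the first step, the positions of the other letters relative to
the strand of the largest entry in the second. Deleting that strand also shows by induction that
any two reduced words are joined by moves. -/

namespace PermGraph

/-! ### Rewriting words by moves -/

/-- `u` can be rewritten to `v` by `b` long braid moves and `c` commutation moves. -/
inductive Rewrites : ℕ → ℕ → List ℕ → List ℕ → Prop
  | refl (w : List ℕ) : Rewrites 0 0 w w
  | comm {b c : ℕ} {u v w : List ℕ} :
      CommutationMove u v → Rewrites b c v w → Rewrites b (c + 1) u w
  | braid {b c : ℕ} {u v w : List ℕ} :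
      LongBraidMove u v → Rewrites b c v w → Rewrites (b + 1) c u w

theorem CommutationMove.symm {u v : List ℕ} (h : CommutationMove u v) : CommutationMove v u := by
  obtain ⟨x, y, j, k, hjk, rfl, rfl⟩ := h
  exact ⟨x, y, k, j, hjk.symm, rfl, rfl⟩

theorem LongBraidMove.symm {u v : List ℕ} (h : LongBraidMove u v) : LongBraidMove v u := by
  obtain ⟨x, y, j, ⟨rfl, rfl⟩ | ⟨rfl, rfl⟩⟩ := h
  · exact ⟨x, y, j, Or.inr ⟨rfl, rfl⟩⟩
  · exact ⟨x, y, j, Or.inl ⟨rfl, rfl⟩⟩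

theorem CommutationMove.append {u v : List ℕ} (h : CommutationMove u v) (x y : List ℕ) :
    CommutationMove (x ++ u ++ y) (x ++ v ++ y) := by
  obtain ⟨x', y', j, k, hjk, rfl, rfl⟩ := h
  exact ⟨x ++ x', y' ++ y, j, k, hjk, by simp, by simp⟩

theorem LongBraidMove.append {u v : List ℕ} (h : LongBraidMove u v) (x y : List ℕ) :
    LongBraidMove (x ++ u ++ y) (x ++ v ++ y) := by
  obtain ⟨x', y', j, ⟨rfl, rfl⟩ | ⟨rfl, rfl⟩⟩ := h
  · exact ⟨x ++ x', y' ++ y, j, Or.inl ⟨by simp, by simp⟩⟩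
  · exact ⟨x ++ x', y' ++ y, j, Or.inr ⟨by simp, by simp⟩⟩

theorem CommutationMove.map {f : ℕ → ℕ} (hf : ∀ j k, j + 1 < k → f j + 1 < f k)
    {u v : List ℕ} (h : CommutationMove u v) : CommutationMove (u.map f) (v.map f) := by
  obtain ⟨x, y, j, k, hjk, rfl, rfl⟩ := h
  exact ⟨x.map f, y.map f, f j, f k, hjk.imp (hf _ _) (hf _ _), by simp, by simp⟩

theorem LongBraidMove.map {f : ℕ → ℕ} {u v : List ℕ}
    (hf : ∀ j, j ∈ u → j + 1 ∈ u → f (j + 1) = f j + 1) (h : LongBraidMove u v) :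
    LongBraidMove (u.map f) (v.map f) := by
  obtain ⟨x, y, j, ⟨rfl, rfl⟩ | ⟨rfl, rfl⟩⟩ := h <;> have hj := hf j (by simp) (by simp)
  · exact ⟨x.map f, y.map f, f j, Or.inl ⟨by simp [hj], by simp [hj]⟩⟩
  · exact ⟨x.map f, y.map f, f j, Or.inr ⟨by simp [hj], by simp [hj]⟩⟩

namespace Rewrites

variable {b c b' c' : ℕ} {u v w : List ℕ}

theorem trans (h : Rewrites b c u v) (h' : Rewrites b' c' v w) :
    Rewrites (b + b') (c + c') u w := by
  induction h with
  | refl => simpa using h'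
  | comm hm _ ih => rw [Nat.add_right_comm]; exact .comm hm (ih h')
  | braid hm _ ih => rw [Nat.add_right_comm]; exact .braid hm (ih h')

theorem of_comm (h : CommutationMove u v) : Rewrites 0 1 u v := .comm h (.refl _)

theorem of_braid (h : LongBraidMove u v) : Rewrites 1 0 u v := .braid h (.refl _)

theorem symm (h : Rewrites b c u v) : Rewrites b c v u := by
  induction h with
  | refl => exact .refl _
  | comm hm _ ih => exact ih.trans (of_comm hm.symm)
  | braid hm _ ih => exact ih.trans (of_braid hm.symm)

theorem append (h : Rewrites b c u v) (x y : List ℕ) :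
    Rewrites b c (x ++ u ++ y) (x ++ v ++ y) := by
  induction h with
  | refl => exact .refl _
  | comm hm _ ih => exact .comm (hm.append x y) ih
  | braid hm _ ih => exact .braid (hm.append x y) ih

theorem append_left (h : Rewrites b c u v) (x : List ℕ) : Rewrites b c (x ++ u) (x ++ v) := by
  simpa using h.append x []

theorem append_right (h : Rewrites b c u v) (y : List ℕ) : Rewrites b c (u ++ y) (v ++ y) := by
  simpa using h.append [] y

theorem cons (h : Rewrites b c u v) (p : ℕ) : Rewrites b c (p :: u) (p :: v) :=
  h.append_left [p]

theorem mem_iff (h : Rewrites b c u v) (p : ℕ) : p ∈ u ↔ p ∈ v := by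
  induction h with
  | refl => rfl
  | comm hm _ ih =>
    obtain ⟨x, y, j, k, -, rfl, rfl⟩ := hm
    rw [← ih]; simp only [List.mem_append, List.mem_cons]; tauto
  | braid hm _ ih =>
    obtain ⟨x, y, j, ⟨rfl, rfl⟩ | ⟨rfl, rfl⟩⟩ := hm <;>
      (rw [← ih]; simp only [List.mem_append, List.mem_cons]; tauto)

theorem length_eq (h : Rewrites b c u v) : u.length = v.length := by
  induction h with
  | refl => rfl
  | comm hm _ ih =>
    obtain ⟨x, y, j, k, -, rfl, rfl⟩ := hm
    simpa using ih
  | braid hm _ ih =>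
    obtain ⟨x, y, j, ⟨rfl, rfl⟩ | ⟨rfl, rfl⟩⟩ := hm <;> simpa using ih

theorem map {f : ℕ → ℕ} (hfar : ∀ j k, j + 1 < k → f j + 1 < f k) (h : Rewrites b c u v)
    (hnear : ∀ j, j ∈ u → j + 1 ∈ u → f (j + 1) = f j + 1) :
    Rewrites b c (u.map f) (v.map f) := by
  induction h with
  | refl => exact .refl _
  | comm hm _ ih =>
    simp only [(of_comm hm).mem_iff] at hnear
    exact .comm (hm.map hfar) (ih hnear)
  | braid hm _ ih =>
    have hm' := hm.map hnear
    simp only [(of_braid hm).mem_iff] at hnear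
    exact .braid hm' (ih hnear)

theorem map_add (h : Rewrites b c u v) (a : ℕ) :
    Rewrites b c (u.map (· + a)) (v.map (· + a)) :=
  h.map (fun j k hjk => by omega) fun j _ _ => by omega

theorem cons_far {p : ℕ} (l : List ℕ) (h : ∀ k ∈ l, k + 1 < p ∨ p + 1 < k) :
    Rewrites 0 l.length (p :: l) (l ++ [p]) := by
  induction l with
  | nil => exact .refl _
  | cons k l ih =>
    simp only [List.mem_cons, forall_eq_or_imp] at h
    exact .comm ⟨[], l, p, k, h.1.symm, rfl, rfl⟩ ((ih h.2).cons k)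

theorem append_far (x y : List ℕ) (h : ∀ j ∈ x, ∀ k ∈ y, k + 1 < j ∨ j + 1 < k) :
    Rewrites 0 (x.length * y.length) (x ++ y) (y ++ x) := by
  induction x with
  | nil => simpa using refl y
  | cons j x ih =>
    simp only [List.mem_cons, forall_eq_or_imp] at h
    have := ((ih h.2).cons j).trans ((cons_far y h.1).append_right x)
    simpa [Nat.add_mul] using this

end Rewrites

/-- The least weight of a sequence of moves that rewrites `u` to `v`, where a long braid move has
weight `α` and a commutation move has weight `β`; it is `⊤` if there is no such sequence. -/
noncomputable def weightedDist (α β : ℕ) (u v : List ℕ) : ℕ∞ :=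
  ⨅ (b : ℕ) (c : ℕ) (_ : Rewrites b c u v), ((α * b + β * c : ℕ) : ℕ∞)

section weightedDist

variable {α β b c : ℕ} {u v w : List ℕ}

theorem Rewrites.weightedDist_le (h : Rewrites b c u v) :
    weightedDist α β u v ≤ (α * b + β * c : ℕ) :=
  iInf_le_of_le b <| iInf_le_of_le c <| iInf_le _ h

theorem le_weightedDist_iff {d : ℕ∞} :
    d ≤ weightedDist α β u v ↔ ∀ b c, Rewrites b c u v → d ≤ (α * b + β * c : ℕ) := by
  simp only [weightedDist, le_iInf_iff]

theorem weightedDist_self (α β : ℕ) (u : List ℕ) : weightedDist α β u u = 0 := by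
  simpa using (Rewrites.refl u).weightedDist_le (α := α) (β := β)

theorem weightedDist_comm (α β : ℕ) (u v : List ℕ) :
    weightedDist α β u v = weightedDist α β v u := by
  have hle (u v : List ℕ) : weightedDist α β u v ≤ weightedDist α β v u :=
    le_weightedDist_iff.2 fun b c h => h.symm.weightedDist_le
  exact (hle u v).antisymm (hle v u)

theorem weightedDist_triangle (α β : ℕ) (u v w : List ℕ) :
    weightedDist α β u w ≤ weightedDist α β u v + weightedDist α β v w := by
  simp only [weightedDist, ENat.iInf_add, ENat.add_iInf, le_iInf_iff]
  intro b' c' h' b c h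
  refine (h.trans h').weightedDist_le.trans ?_
  norm_cast
  linarith

end weightedDist

/-! ### Words as permutations of the natural numbers -/

/-- The product of the simple reflections of a word, as a permutation of `ℕ`; working in `ℕ` makes
words for permutations of different sizes comparable. -/
def wordPerm (w : List ℕ) : Equiv.Perm ℕ := (w.map fun i => Equiv.swap i (i + 1)).prod

theorem wordPerm_nil : wordPerm [] = 1 := rfl

theorem wordPerm_cons (p : ℕ) (w : List ℕ) :
    wordPerm (p :: w) = Equiv.swap p (p + 1) * wordPerm w := by
  simp [wordPerm]

theorem wordPerm_append (x y : List ℕ) : wordPerm (x ++ y) = wordPerm x * wordPerm y := by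
  simp [wordPerm]

theorem swap_succ_apply (p x : ℕ) :
    Equiv.swap p (p + 1) x = if x = p then p + 1 else if x = p + 1 then p else x :=
  Equiv.swap_apply_def _ _ _

theorem wordPerm_cons_apply (p : ℕ) (w : List ℕ) (x : ℕ) :
    wordPerm (p :: w) x =
      if wordPerm w x = p then p + 1 else if wordPerm w x = p + 1 then p else wordPerm w x := by
  rw [wordPerm_cons, Equiv.Perm.mul_apply, swap_succ_apply]

theorem Rewrites.wordPerm_eq {b c : ℕ} {u v : List ℕ} (h : Rewrites b c u v) :
    wordPerm u = wordPerm v := by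
  induction h with
  | refl => rfl
  | comm hm _ ih =>
    obtain ⟨x, y, j, k, hjk, rfl, rfl⟩ := hm
    have key : wordPerm [j, k] = wordPerm [k, j] := by
      ext z
      simp only [wordPerm_cons_apply, wordPerm_nil, Equiv.Perm.one_apply]
      grind
    rw [← ih]
    simp only [wordPerm_append, key]
  | braid hm _ ih =>
    have key (j : ℕ) : wordPerm [j, j + 1, j] = wordPerm [j + 1, j, j + 1] := by
      ext z
      simp only [wordPerm_cons_apply, wordPerm_nil, Equiv.Perm.one_apply]
      grind
    obtain ⟨x, y, j, ⟨rfl, rfl⟩ | ⟨rfl, rfl⟩⟩ := hm <;>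
      rw [← ih] <;> simp only [wordPerm_append, key]

theorem wordPerm_lt_iff {a : ℕ} {w : List ℕ} (h : ∀ p ∈ w, p + 1 ≠ a) (x : ℕ) :
    wordPerm w x < a ↔ x < a := by
  induction w with
  | nil => rfl
  | cons p w ih =>
    simp only [List.mem_cons, forall_eq_or_imp] at h
    rw [wordPerm_cons_apply, ← ih h.2]
    split_ifs <;> omega

theorem wordPerm_of_le {n : ℕ} {w : List ℕ} (h : ∀ p ∈ w, p + 1 < n) {x : ℕ} (hx : n ≤ x) :
    wordPerm w x = x := by
  induction w with
  | nil => rfl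
  | cons p w ih =>
    simp only [List.mem_cons, forall_eq_or_imp] at h
    rw [wordPerm_cons_apply, ih h.2, if_neg (by omega), if_neg (by omega)]

/-! ### Reduced words -/

/-- `w` is a word of minimal length for its permutation. -/
def IsReduced (w : List ℕ) : Prop := ∀ v, wordPerm v = wordPerm w → w.length ≤ v.length

theorem exists_isReduced (w : List ℕ) : ∃ v, IsReduced v ∧ wordPerm v = wordPerm w := by
  obtain ⟨v, hv, hmin⟩ := exists_minimalFor_of_wellFoundedLT
    (fun v => wordPerm v = wordPerm w) List.length ⟨w, rfl⟩
  exact ⟨v, fun x hx => not_lt.1 fun hlt => hlt.not_ge (hmin (hx.trans hv) hlt.le), hv⟩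

namespace IsReduced

variable {u v w : List ℕ}

theorem length_eq (hu : IsReduced u) (hv : IsReduced v) (h : wordPerm u = wordPerm v) :
    u.length = v.length :=
  (hu v h.symm).antisymm (hv u h)

theorem of_length_le (hu : IsReduced u) (h : wordPerm v = wordPerm u)
    (hl : v.length ≤ u.length) : IsReduced v :=
  fun x hx => hl.trans (hu x (hx.trans h))

theorem rewrites {b c : ℕ} (hu : IsReduced u) (h : Rewrites b c u v) : IsReduced v :=
  hu.of_length_le h.wordPerm_eq.symm h.length_eq.ge

theorem of_append_left (h : IsReduced (u ++ v)) : IsReduced u := fun x hx => by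
  simpa using h (x ++ v) (by simp only [wordPerm_append, hx])

theorem of_append_right (h : IsReduced (u ++ v)) : IsReduced v := fun x hx => by
  simpa using h (u ++ x) (by simp only [wordPerm_append, hx])

theorem of_cons {p : ℕ} (h : IsReduced (p :: w)) : IsReduced w :=
  of_append_right (u := [p]) h

end IsReduced

/-- The exchange property. -/
theorem exists_wordPerm_eq_swap_mul {p : ℕ} {w : List ℕ}
    (h : (wordPerm w).symm (p + 1) < (wordPerm w).symm p) :
    ∃ z, z.length + 1 = w.length ∧ wordPerm z = Equiv.swap p (p + 1) * wordPerm w := by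
  induction w using List.reverseRecOn with
  | nil => exact absurd h p.lt_succ_self.asymm
  | append_singleton y t ih =>
    by_cases hy : (wordPerm y).symm (p + 1) < (wordPerm y).symm p
    · obtain ⟨z, hz, hzp⟩ := ih hy
      exact ⟨z ++ [t], by simp [hz], by rw [wordPerm_append, wordPerm_append, hzp, mul_assoc]⟩
    · have : (wordPerm y).symm p ≠ (wordPerm y).symm (p + 1) := by simp
      have happ (x : ℕ) : (wordPerm (y ++ [t])).symm x =
          Equiv.swap t (t + 1) ((wordPerm y).symm x) := by
        simp [wordPerm_append, wordPerm_cons, wordPerm_nil, Equiv.Perm.mul_def]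
      simp only [happ, swap_succ_apply] at h
      obtain ⟨hp, hp'⟩ : (wordPerm y).symm p = t ∧ (wordPerm y).symm (p + 1) = t + 1 := by
        split_ifs at h <;> omega
      refine ⟨y, by simp, ?_⟩
      rw [Equiv.symm_apply_eq] at hp hp'
      rw [wordPerm_append, wordPerm_cons, wordPerm_nil, mul_one, Equiv.mul_swap_eq_swap_mul, ← hp,
        ← hp', Equiv.swap_mul_self_mul]

theorem IsReduced.symm_lt_symm {p : ℕ} {w : List ℕ} (h : IsReduced (p :: w)) :
    (wordPerm w).symm p < (wordPerm w).symm (p + 1) := by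
  by_contra hlt
  have hne : (wordPerm w).symm p ≠ (wordPerm w).symm (p + 1) := by simp
  obtain ⟨z, hz, hzp⟩ := exists_wordPerm_eq_swap_mul (p := p) (w := w) (by omega)
  have := h z (by rw [hzp, wordPerm_cons])
  simp only [List.length_cons] at this
  omega

theorem IsReduced.exists_inversion {a : ℕ} {w : List ℕ} (h : IsReduced w)
    (ha : ∃ p ∈ w, p + 1 = a) : ∃ i j, i < j ∧ wordPerm w j < a ∧ a ≤ wordPerm w i := by
  induction w with
  | nil => simp at ha
  | cons p w ih =>
    by_cases hpa : p + 1 = a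
    · refine ⟨_, _, h.symm_lt_symm, ?_, ?_⟩ <;> simp [wordPerm_cons_apply, ← hpa]
    · obtain ⟨i, j, hij, hj, hi⟩ := ih h.of_cons (by simpa [hpa] using ha)
      refine ⟨i, j, hij, ?_, ?_⟩ <;> rw [wordPerm_cons_apply] <;> split_ifs <;> omega

theorem IsReduced.succ_ne {a : ℕ} {w : List ℕ} (h : IsReduced w)
    (hw : ∀ x, wordPerm w x < a ↔ x < a) : ∀ p ∈ w, p + 1 ≠ a := by
  by_contra! hc
  obtain ⟨i, j, hij, hj, hi⟩ := h.exists_inversion hc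
  rw [hw] at hj
  rw [← not_lt, hw] at hi
  omega

theorem IsReduced.succ_lt {n : ℕ} {w : List ℕ} (h : IsReduced w)
    (hw : ∀ x, n ≤ x → wordPerm w x = x) : ∀ p ∈ w, p + 1 < n := by
  intro p hp
  by_contra! hn
  refine h.succ_ne (a := p + 1) (fun x => ?_) p hp rfl
  by_cases hx : n ≤ x
  · rw [hw x hx]
  · refine iff_of_true (not_le.1 fun hle => hx ?_) (by omega)
    rw [← (wordPerm w).injective (hw _ (hn.trans hle))]
    omega

/-! ### Finite permutations inside the permutations of `ℕ` -/

/-- The permutation of `ℕ` that extends `π` by the identity on the numbers `≥ n`. -/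
noncomputable def toNatPerm {n : ℕ} : Equiv.Perm (Fin n) →* Equiv.Perm ℕ :=
  Equiv.Perm.viaEmbeddingHom Fin.valEmbedding

/-- The permutation `σ` of `ℕ` moved to the numbers `≥ a`, with the numbers `< a` fixed. -/
noncomputable def shift (a : ℕ) : Equiv.Perm ℕ →* Equiv.Perm ℕ :=
  Equiv.Perm.viaEmbeddingHom (addRightEmbedding a)

section

variable {n a x : ℕ}

theorem toNatPerm_apply (π : Equiv.Perm (Fin n)) (x : Fin n) : toNatPerm π x = π x :=
  Equiv.Perm.viaEmbedding_apply π Fin.valEmbedding x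

theorem toNatPerm_of_le (π : Equiv.Perm (Fin n)) (h : n ≤ x) : toNatPerm π x = x :=
  Equiv.Perm.viaEmbedding_apply_of_notMem π Fin.valEmbedding x <| by
    rintro ⟨y, rfl⟩
    exact y.is_lt.not_ge h

theorem toNatPerm_injective : Function.Injective (toNatPerm (n := n)) :=
  Equiv.Perm.viaEmbeddingHom_injective _

theorem shift_apply_add (σ : Equiv.Perm ℕ) (x : ℕ) : shift a σ (x + a) = σ x + a :=
  Equiv.Perm.viaEmbedding_apply σ (addRightEmbedding a) x

theorem shift_of_lt (σ : Equiv.Perm ℕ) (h : x < a) : shift a σ x = x :=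
  Equiv.Perm.viaEmbedding_apply_of_notMem σ (addRightEmbedding a) x <| by
    rintro ⟨y, rfl⟩
    exact (Nat.le_add_left a y).not_gt h

theorem viaEmbedding_swap {α β : Type*} [DecidableEq α] [DecidableEq β] (f : α ↪ β) (x y : α) :
    (Equiv.swap x y).viaEmbedding f = Equiv.swap (f x) (f y) := by
  ext z
  by_cases hz : z ∈ Set.range f
  · obtain ⟨z, rfl⟩ := hz
    rw [Equiv.Perm.viaEmbedding_apply, f.injective.map_swap]
  · rw [Equiv.Perm.viaEmbedding_apply_of_notMem _ _ _ hz, Equiv.swap_apply_of_ne_of_ne] <;>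
      rintro rfl <;> exact hz ⟨_, rfl⟩

theorem toNatPerm_simpleReflection {i : ℕ} (h : i + 1 < n) :
    toNatPerm (simpleReflection n i) = Equiv.swap i (i + 1) := by
  rw [simpleReflection, dif_pos h]
  exact viaEmbedding_swap Fin.valEmbedding _ _

theorem wordPerm_map_add (a : ℕ) (w : List ℕ) :
    wordPerm (w.map (· + a)) = shift a (wordPerm w) := by
  induction w with
  | nil => exact (map_one _).symm
  | cons p w ih =>
    rw [List.map_cons, wordPerm_cons, wordPerm_cons, map_mul, ih, Nat.add_right_comm]
    exact congrArg (· * _) (viaEmbedding_swap (addRightEmbedding a) p (p + 1)).symm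

end

/-- The reduced words of a permutation of `ℕ`. -/
def reducedWords (σ : Equiv.Perm ℕ) : Set (List ℕ) := {w | IsReduced w ∧ wordPerm w = σ}

section

variable {n : ℕ} {π : Equiv.Perm (Fin n)} {σ : Equiv.Perm ℕ} {w : List ℕ}

theorem nonempty_reducedWords_wordPerm (w : List ℕ) : (reducedWords (wordPerm w)).Nonempty :=
  exists_isReduced w

theorem length_eq_of_mem_reducedWords {v : List ℕ} (hv : v ∈ reducedWords σ)
    (hw : w ∈ reducedWords σ) : v.length = w.length :=
  hv.1.length_eq hw.1 (hv.2.trans hw.2.symm)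

theorem succ_lt_of_mem_reducedWords (hσ : ∀ x, n ≤ x → σ x = x) (hw : w ∈ reducedWords σ) :
    ∀ p ∈ w, p + 1 < n :=
  hw.1.succ_lt fun x hx => by rw [hw.2, hσ x hx]

theorem isWord_iff : IsWord π w ↔ (∀ p ∈ w, p + 1 < n) ∧ wordPerm w = toNatPerm π := by
  refine and_congr_right fun hw => ?_
  have key : wordPerm w = toNatPerm (w.map (simpleReflection n)).prod := by
    rw [map_list_prod, List.map_map, wordPerm]
    exact congrArg _ (List.map_congr_left fun p hp => (toNatPerm_simpleReflection (hw p hp)).symm)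
  rw [key, toNatPerm_injective.eq_iff]

theorem isReducedWord_iff : IsReducedWord π w ↔ w ∈ reducedWords (toNatPerm π) := by
  have hfix (x : ℕ) (hx : n ≤ x) : toNatPerm π x = x := toNatPerm_of_le π hx
  constructor
  · rintro ⟨hw, hmin⟩
    obtain ⟨v, hv⟩ := nonempty_reducedWords_wordPerm w
    have hσ := (isWord_iff.1 hw).2
    rw [hσ] at hv
    have hvw := isWord_iff.2 ⟨succ_lt_of_mem_reducedWords hfix hv, hv.2⟩
    exact ⟨hv.1.of_length_le (hσ.trans hv.2.symm) (hmin v hvw), hσ⟩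
  · intro hw
    refine ⟨isWord_iff.2 ⟨succ_lt_of_mem_reducedWords hfix hw, hw.2⟩, fun v hv => hw.1 v ?_⟩
    rw [(isWord_iff.1 hv).2, hw.2]

theorem IsReducedWord.length_eq (h : IsReducedWord π w) : length π = w.length := by
  have hleast : IsLeast {k | ∃ w, IsWord π w ∧ w.length = k} w.length := by
    refine ⟨⟨w, h.1, rfl⟩, ?_⟩
    rintro _ ⟨v, hv, rfl⟩
    exact h.2 v hv
  exact hleast.csInf_eq

theorem exists_wordPerm_eq_toNatPerm (π : Equiv.Perm (Fin n)) : ∃ w, wordPerm w = toNatPerm π := by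
  obtain _ | n := n
  · exact ⟨[], by rw [Subsingleton.elim π 1, map_one, wordPerm_nil]⟩
  have hπ : π ∈ Submonoid.closure (Set.range fun i : Fin n => Equiv.swap i.castSucc i.succ) := by
    rw [Equiv.Perm.mclosure_swap_castSucc_succ]
    trivial
  induction hπ using Submonoid.closure_induction with
  | mem π hπ =>
    obtain ⟨i, rfl⟩ := hπ
    exact ⟨[i], (viaEmbedding_swap Fin.valEmbedding i.castSucc i.succ).symm⟩
  | one => exact ⟨[], (map_one _).symm⟩
  | mul π ρ _ _ hπ hρ =>
    obtain ⟨⟨u, hu⟩, ⟨v, hv⟩⟩ := And.intro hπ hρ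
    exact ⟨u ++ v, by rw [wordPerm_append, hu, hv, map_mul]⟩

theorem nonempty_reducedWords_toNatPerm (π : Equiv.Perm (Fin n)) :
    (reducedWords (toNatPerm π)).Nonempty := by
  obtain ⟨w, hw⟩ := exists_wordPerm_eq_toNatPerm π
  exact hw ▸ nonempty_reducedWords_wordPerm w

end

/-! ### Diameters of sets -/

/-- The diameter of `S` with respect to the extended distance `d`. -/
noncomputable def extDiam {X : Type*} (d : X → X → ℕ∞) (S : Set X) : ℕ∞ :=
  ⨆ x ∈ S, ⨆ y ∈ S, d x y

section extDiam

variable {X Y : Type*} {d : X → X → ℕ∞} {d' : Y → Y → ℕ∞} {S : Set X} {T : Set Y} {e : ℕ∞}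

theorem le_extDiam {x y : X} (hx : x ∈ S) (hy : y ∈ S) : d x y ≤ extDiam d S :=
  le_iSup₂_of_le x hx (le_iSup₂_of_le y hy le_rfl)

theorem extDiam_le_iff : extDiam d S ≤ e ↔ ∀ x ∈ S, ∀ y ∈ S, d x y ≤ e := by
  simp only [extDiam, iSup_le_iff]

theorem extDiam_add (hS : S.Nonempty) :
    extDiam d S + e = extDiam (fun x y => d x y + e) S := by
  simp only [extDiam, ENat.biSup_add hS]

theorem extDiam_prod (hS : S.Nonempty) (hT : T.Nonempty) :
    extDiam (fun p q : X × Y => d p.1 q.1 + d' p.2 q.2) (S ×ˢ T) =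
      extDiam d S + extDiam d' T := by
  apply le_antisymm
  · exact extDiam_le_iff.2 fun p hp q hq =>
      add_le_add (le_extDiam hp.1 hq.1) (le_extDiam hp.2 hq.2)
  · refine ENat.biSup_add_biSup_le hS hT fun x hx y hy => ?_
    refine ENat.biSup_add_biSup_le hS hT fun x' hx' y' hy' => ?_
    exact le_extDiam (d := fun p q : X × Y => d p.1 q.1 + d' p.2 q.2) (x := (x, y))
      (y := (x', y')) ⟨hx, hy⟩ ⟨hx', hy'⟩

/-- Every `x` lies on a path of length at most `e` between two antipodal copies `lo` and `hi` of
`T`, so two points of `S` can be joined through either copy, and the average of the two routes has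
length at most `d' + e`. -/
theorem extDiam_eq_add_of_antipodal (hsymm : ∀ x y, d x y = d y x)
    (htri : ∀ x y z, d x z ≤ d x y + d y z) {proj : X → Y} {lo hi : Y → X}
    (hT : T.Nonempty) (hproj : ∀ x ∈ S, proj x ∈ T) (hlo : ∀ y ∈ T, lo y ∈ S)
    (hhi : ∀ y ∈ T, hi y ∈ S) (hdlo : ∀ y ∈ T, ∀ y' ∈ T, d (lo y) (lo y') ≤ d' y y')
    (hdhi : ∀ y ∈ T, ∀ y' ∈ T, d (hi y) (hi y') ≤ d' y y')
    (hpath : ∀ x ∈ S, d x (lo (proj x)) + d x (hi (proj x)) ≤ e)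
    (hfar : ∀ y ∈ T, ∀ y' ∈ T, d' y y' + e ≤ d (lo y) (hi y')) :
    extDiam d S = extDiam d' T + e := by
  rw [extDiam_add hT]
  apply le_antisymm
  · refine extDiam_le_iff.2 fun x hx y hy => le_trans ?_
      (le_extDiam (d := fun x y => d' x y + e) (hproj x hx) (hproj y hy))
    have route (f : Y → X) (hf : ∀ y ∈ T, ∀ y' ∈ T, d (f y) (f y') ≤ d' y y') :
        d x y ≤ d x (f (proj x)) + d' (proj x) (proj y) + d y (f (proj y)) :=
      (htri x (f (proj y)) y).trans <| by
        rw [hsymm _ y]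
        grw [htri x (f (proj x)), hf _ (hproj x hx) _ (hproj y hy)]
    have hle := (add_le_add (route lo hdlo) (route hi hdhi)).trans_eq <| show _ =
      (d x (lo (proj x)) + d x (hi (proj x))) + (d y (lo (proj y)) + d y (hi (proj y))) +
        (d' (proj x) (proj y) + d' (proj x) (proj y)) by ring
    grw [hpath x hx, hpath y hy] at hle
    by_contra! hlt
    refine (ENat.add_lt_add hlt hlt).not_ge (hle.trans_eq ?_)
    ring
  · exact extDiam_le_iff.2 fun y hy y' hy' =>
      (hfar y hy y' hy').trans (le_extDiam (hlo y hy) (hhi y' hy'))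

end extDiam

/-! ### Direct sums -/

/-- The letters less than `a`. -/
def small (a : ℕ) (w : List ℕ) : List ℕ := w.filter (· < a)

/-- The letters that are at least `a`, diminished by `a`. -/
def big (a : ℕ) (w : List ℕ) : List ℕ := (w.filter (a ≤ ·)).map (· - a)

/-- The number of pairs of a letter that is at least `a` and a later letter that is less than
`a`. -/
def mixed (a : ℕ) : List ℕ → ℕ
  | [] => 0
  | p :: w => (if p < a then 0 else (small a w).length) + mixed a w

section

variable {a p : ℕ} {u v w : List ℕ}

theorem small_append (a : ℕ) (x y : List ℕ) : small a (x ++ y) = small a x ++ small a y := by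
  simp [small]

theorem big_append (a : ℕ) (x y : List ℕ) : big a (x ++ y) = big a x ++ big a y := by
  simp [big]

theorem small_cons_of_lt (h : p < a) : small a (p :: w) = p :: small a w := by
  simp [small, h]

theorem small_cons_of_le (h : a ≤ p) : small a (p :: w) = small a w := by
  simp [small, h]

theorem big_cons_of_lt (h : p < a) : big a (p :: w) = big a w := by
  simp [big, h]

theorem big_cons_of_le (h : a ≤ p) : big a (p :: w) = (p - a) :: big a w := by
  simp [big, h]

theorem small_of_lt (h : ∀ p ∈ w, p < a) : small a w = w := by
  simpa [small] using h

theorem big_of_lt (h : ∀ p ∈ w, p < a) : big a w = [] := by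
  simpa [big] using h

theorem small_map_add (a : ℕ) (w : List ℕ) : small a (w.map (· + a)) = [] := by
  simp [small]

theorem big_map_add (a : ℕ) (w : List ℕ) : big a (w.map (· + a)) = w := by
  induction w with
  | nil => rfl
  | cons p w ih => rw [List.map_cons, big_cons_of_le (by omega), ih, Nat.add_sub_cancel]

theorem length_small_add_length_big (a : ℕ) (w : List ℕ) :
    (small a w).length + (big a w).length = w.length := by
  rw [small, big, List.length_map, w.length_eq_length_filter_add (fun p => decide (p < a))]
  simp only [← decide_not, not_lt]

theorem mixed_append (a : ℕ) (x y : List ℕ) :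
    mixed a (x ++ y) = mixed a x + mixed a y + (big a x).length * (small a y).length := by
  induction x with
  | nil => simp [mixed, big]
  | cons p x ih =>
    rw [List.cons_append, mixed, mixed, ih, small_append, List.length_append]
    rcases lt_or_ge p a with hp | hp
    · rw [if_pos hp, if_pos hp, big_cons_of_lt hp]
      ring
    · rw [if_neg hp.not_gt, if_neg hp.not_gt, big_cons_of_le hp, List.length_cons]
      ring

theorem mixed_of_lt (h : ∀ p ∈ w, p < a) : mixed a w = 0 := by
  induction w with
  | nil => rfl
  | cons p w ih =>
    simp only [List.mem_cons, forall_eq_or_imp] at h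
    rw [mixed, if_pos h.1, ih h.2]

theorem mixed_map_add (a : ℕ) (w : List ℕ) : mixed a (w.map (· + a)) = 0 := by
  induction w with
  | nil => rfl
  | cons p w ih => simp [mixed, small_map_add, ih]

theorem succ_lt_of_mem_small (h : ∀ p ∈ w, p + 1 ≠ a) : ∀ p ∈ small a w, p + 1 < a := by
  intro p hp
  simp only [small, List.mem_filter, decide_eq_true_eq] at hp
  have := h p hp.1
  omega

theorem Rewrites.small_append_big (h : ∀ p ∈ w, p + 1 ≠ a) :
    Rewrites 0 (mixed a w) w (small a w ++ (big a w).map (· + a)) := by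
  induction w with
  | nil => exact .refl _
  | cons p w ih =>
    simp only [List.mem_cons, forall_eq_or_imp] at h
    have hw := (ih h.2).cons p
    rcases lt_or_ge p a with hp | hp
    · simpa [mixed, small_cons_of_lt hp, big_cons_of_lt hp, hp] using hw
    · have hfar : Rewrites 0 (small a w).length (p :: small a w) (small a w ++ [p]) :=
        .cons_far _ fun k hk => .inl ((succ_lt_of_mem_small h.2 k hk).trans_le hp)
      have := hw.trans (hfar.append_right ((big a w).map (· + a)))
      simpa [mixed, small_cons_of_le hp, big_cons_of_le hp, hp, not_lt.2 hp, Nat.add_comm]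
        using this

theorem Rewrites.big_append_small (h : ∀ p ∈ w, p + 1 ≠ a) :
    ∃ c, Rewrites 0 c w ((big a w).map (· + a) ++ small a w) ∧
      c + mixed a w = (small a w).length * (big a w).length := by
  induction w with
  | nil => exact ⟨0, .refl _, rfl⟩
  | cons p w ih =>
    simp only [List.mem_cons, forall_eq_or_imp] at h
    obtain ⟨c, hc, hcm⟩ := ih h.2
    rcases lt_or_ge p a with hp | hp
    · have hfar : Rewrites 0 ((big a w).map (· + a)).length (p :: (big a w).map (· + a))
          ((big a w).map (· + a) ++ [p]) :=
        .cons_far _ fun k hk => by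
          have := h.1
          simp only [List.mem_map] at hk
          omega
      have := (hc.cons p).trans (hfar.append_right (small a w))
      refine ⟨c + (big a w).length, ?_, ?_⟩
      · simpa [small_cons_of_lt hp, big_cons_of_lt hp] using this
      · rw [mixed, if_pos hp, small_cons_of_lt hp, big_cons_of_lt hp, List.length_cons,
          Nat.add_mul, ← hcm]
        ring
    · refine ⟨c, ?_, ?_⟩
      · simpa [small_cons_of_le hp, big_cons_of_le hp, hp] using hc.cons p
      · rw [mixed, if_neg hp.not_gt, small_cons_of_le hp, big_cons_of_le hp, List.length_cons,
          Nat.mul_add, ← hcm]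
        ring

theorem CommutationMove.exists_rewrites_small_big (a : ℕ) (h : CommutationMove u v) :
    ∃ c₁ c₂, Rewrites 0 c₁ (small a u) (small a v) ∧ Rewrites 0 c₂ (big a u) (big a v) ∧
      c₁ + c₂ + mixed a v ≤ 1 + mixed a u := by
  obtain ⟨x, y, j, k, hjk, rfl, rfl⟩ := h
  simp only [small_append, big_append, mixed_append]
  rcases lt_or_ge j a with hj | hj <;> rcases lt_or_ge k a with hk | hk
  · refine ⟨1, 0, .of_comm ⟨small a x, small a y, j, k, hjk, ?_, ?_⟩, ?_, ?_⟩ <;>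
      simp [small, big, mixed, hj, hk, Rewrites.refl]
  · refine ⟨0, 0, ?_, ?_, ?_⟩ <;>
      simp [small, big, mixed, hj, hj.not_ge, hk, hk.not_gt, Rewrites.refl]
    omega
  · refine ⟨0, 0, ?_, ?_, ?_⟩ <;>
      simp [small, big, mixed, hj, hj.not_gt, hk, hk.not_ge, Rewrites.refl]
    omega
  · refine ⟨0, 1, ?_, .of_comm ⟨big a x, big a y, j - a, k - a, by omega, ?_, ?_⟩, ?_⟩ <;>
      simp [small, big, mixed, hj, hk, hj.not_gt, hk.not_gt, Rewrites.refl]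

theorem LongBraidMove.exists_rewrites_small_big (h : LongBraidMove u v)
    (ha : ∀ p ∈ u, p + 1 ≠ a) :
    ∃ b₁ b₂, Rewrites b₁ 0 (small a u) (small a v) ∧ Rewrites b₂ 0 (big a u) (big a v) ∧
      b₁ + b₂ = 1 ∧ mixed a u = mixed a v := by
  have key (x y : List ℕ) (j : ℕ) (hj : j + 1 ≠ a) :
      let u := x ++ [j, j + 1, j] ++ y
      let v := x ++ [j + 1, j, j + 1] ++ y
      ∃ b₁ b₂, Rewrites b₁ 0 (small a u) (small a v) ∧ Rewrites b₂ 0 (big a u) (big a v) ∧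
        b₁ + b₂ = 1 ∧ mixed a u = mixed a v := by
    simp only [small_append, big_append, mixed_append]
    rcases lt_or_ge j a with hja | hja
    · have hja' : j + 1 < a := by omega
      refine ⟨1, 0, .of_braid ⟨small a x, small a y, j, Or.inl ⟨?_, ?_⟩⟩, ?_, rfl, ?_⟩ <;>
        simp [small, big, mixed, hja, hja', Rewrites.refl]
    · have hja' : a ≤ j + 1 := by omega
      have hsub : j + 1 - a = j - a + 1 := by omega
      refine ⟨0, 1, ?_, .of_braid ⟨big a x, big a y, j - a, Or.inl ⟨?_, ?_⟩⟩, rfl, ?_⟩ <;>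
        simp [small, big, mixed, hja, hja', hja.not_gt, hja'.not_gt, hsub, Rewrites.refl]
  obtain ⟨x, y, j, ⟨rfl, rfl⟩ | ⟨rfl, rfl⟩⟩ := h
  · exact key x y j (ha j (by simp))
  · obtain ⟨b₁, b₂, h₁, h₂, hb, hm⟩ := key x y j (ha j (by simp))
    exact ⟨b₁, b₂, h₁.symm, h₂.symm, hb, hm.symm⟩

theorem Rewrites.exists_rewrites_small_big {b c : ℕ} (h : Rewrites b c u v)
    (ha : ∀ p ∈ u, p + 1 ≠ a) :
    ∃ b₁ c₁ b₂ c₂, Rewrites b₁ c₁ (small a u) (small a v) ∧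
      Rewrites b₂ c₂ (big a u) (big a v) ∧ b₁ + b₂ = b ∧ c₁ + c₂ + mixed a v ≤ c + mixed a u := by
  induction h with
  | refl w => exact ⟨0, 0, 0, 0, .refl _, .refl _, rfl, by omega⟩
  | comm hm _ ih =>
    obtain ⟨b₁, c₁, b₂, c₂, h₁, h₂, hb, hc⟩ :=
      ih fun p hp => ha p (((of_comm hm).mem_iff p).2 hp)
    obtain ⟨d₁, d₂, h₁', h₂', hd⟩ := hm.exists_rewrites_small_big a
    exact ⟨_, _, _, _, h₁'.trans h₁, h₂'.trans h₂, by omega, by omega⟩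
  | braid hm _ ih =>
    obtain ⟨b₁, c₁, b₂, c₂, h₁, h₂, hb, hc⟩ :=
      ih fun p hp => ha p (((of_braid hm).mem_iff p).2 hp)
    obtain ⟨d₁, d₂, h₁', h₂', hd, hmixed⟩ := hm.exists_rewrites_small_big ha
    exact ⟨_, _, _, _, h₁'.trans h₁, h₂'.trans h₂, by omega, by omega⟩

end

section

variable {a : ℕ} {σ σ' τ τ' : Equiv.Perm ℕ} {w x y : List ℕ}

theorem mul_shift_inj (hσ : ∀ i, a ≤ i → σ i = i) (hσ' : ∀ i, a ≤ i → σ' i = i) :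
    σ * shift a τ = σ' * shift a τ' ↔ σ = σ' ∧ τ = τ' := by
  refine ⟨fun h => ?_, fun ⟨h, h'⟩ => by rw [h, h']⟩
  have hσσ' : σ = σ' := by
    ext i
    rcases lt_or_ge i a with hi | hi
    · simpa [shift_of_lt _ hi] using congrArg (· i) h
    · rw [hσ i hi, hσ' i hi]
  subst hσσ'
  exact ⟨rfl, Equiv.Perm.viaEmbeddingHom_injective _ (mul_left_cancel h)⟩

theorem mul_shift_lt_iff (hσ : ∀ i, a ≤ i → σ i = i) (i : ℕ) :
    (σ * shift a τ) i < a ↔ i < a := by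
  rw [Equiv.Perm.mul_apply]
  rcases lt_or_ge i a with hi | hi
  · rw [shift_of_lt _ hi]
    refine iff_of_true (not_le.1 fun hle => ?_) hi
    rw [σ.injective (hσ _ hle)] at hle
    exact hi.not_ge hle
  · obtain ⟨i, rfl⟩ := Nat.exists_eq_add_of_le' hi
    rw [shift_apply_add, hσ _ (Nat.le_add_left _ _)]
    omega

theorem succ_ne_of_mem_reducedWords_mul_shift (hσ : ∀ i, a ≤ i → σ i = i)
    (hw : w ∈ reducedWords (σ * shift a τ)) : ∀ p ∈ w, p + 1 ≠ a :=
  hw.1.succ_ne fun i => by rw [hw.2, mul_shift_lt_iff hσ]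

theorem small_big_mem_reducedWords (hσ : ∀ i, a ≤ i → σ i = i)
    (hw : w ∈ reducedWords (σ * shift a τ)) :
    small a w ∈ reducedWords σ ∧ big a w ∈ reducedWords τ := by
  have hne := succ_ne_of_mem_reducedWords_mul_shift hσ hw
  have hrw := Rewrites.small_append_big hne
  have hred := hw.1.rewrites hrw
  have hfix (i : ℕ) (hi : a ≤ i) : wordPerm (small a w) i = i :=
    wordPerm_of_le (succ_lt_of_mem_small hne) hi
  have hperm := hrw.wordPerm_eq
  rw [wordPerm_append, wordPerm_map_add, hw.2, mul_shift_inj hσ hfix] at hperm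
  refine ⟨⟨hred.of_append_left, hperm.1.symm⟩, ⟨fun v hv => ?_, hperm.2.symm⟩⟩
  simpa using hred.of_append_right (v.map (· + a)) (by simp only [wordPerm_map_add, hv])

theorem append_map_add_mem_reducedWords (hσ : ∀ i, a ≤ i → σ i = i)
    (hx : x ∈ reducedWords σ) (hy : y ∈ reducedWords τ) :
    x ++ y.map (· + a) ∈ reducedWords (σ * shift a τ) := by
  have hperm : wordPerm (x ++ y.map (· + a)) = σ * shift a τ := by
    rw [wordPerm_append, wordPerm_map_add, hx.2, hy.2]
  obtain ⟨v, hv⟩ := nonempty_reducedWords_wordPerm (x ++ y.map (· + a))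
  rw [hperm] at hv
  obtain ⟨hs, hb⟩ := small_big_mem_reducedWords hσ hv
  refine ⟨hv.1.of_length_le (hperm.trans hv.2.symm) ?_, hperm⟩
  rw [← length_small_add_length_big a v, ← length_eq_of_mem_reducedWords hx hs,
    ← length_eq_of_mem_reducedWords hy hb, List.length_append, List.length_map]

theorem small_big_append_map_add (hx : ∀ p ∈ x, p < a) (y : List ℕ) :
    small a (x ++ y.map (· + a)) = x ∧ big a (x ++ y.map (· + a)) = y ∧
      mixed a (x ++ y.map (· + a)) = 0 := by
  simp [small_append, big_append, mixed_append, small_of_lt hx, big_of_lt hx, mixed_of_lt hx,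
    small_map_add, big_map_add, mixed_map_add]

theorem small_big_map_add_append (hx : ∀ p ∈ x, p < a) (y : List ℕ) :
    small a (y.map (· + a) ++ x) = x ∧ big a (y.map (· + a) ++ x) = y ∧
      mixed a (y.map (· + a) ++ x) = x.length * y.length := by
  simp [small_append, big_append, mixed_append, small_of_lt hx, big_of_lt hx, mixed_of_lt hx,
    small_map_add, big_map_add, mixed_map_add, Nat.mul_comm]

variable {α β : ℕ} {u v : List ℕ}

theorem weightedDist_append_le (α β : ℕ) (u v x y : List ℕ) :
    weightedDist α β (u ++ x) (v ++ y) ≤ weightedDist α β u v + weightedDist α β x y := by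
  simp only [weightedDist, ENat.iInf_add, ENat.add_iInf, le_iInf_iff]
  intro b' c' h' b c h
  refine ((h.append_right x).trans (h'.append_left v)).weightedDist_le.trans_eq ?_
  norm_cast
  ring

theorem weightedDist_map_add_le (α β a : ℕ) (u v : List ℕ) :
    weightedDist α β (u.map (· + a)) (v.map (· + a)) ≤ weightedDist α β u v :=
  le_weightedDist_iff.2 fun _ _ h => (h.map_add a).weightedDist_le

theorem weightedDist_add_weightedDist_add_le {u' v' : List ℕ} (hu : ∀ p ∈ u, p + 1 < a)
    (hu' : ∀ p ∈ u', p < a) :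
    weightedDist α β u u' + weightedDist α β v v' + (β * (u'.length * v'.length) : ℕ) ≤
      weightedDist α β (u ++ v.map (· + a)) (v'.map (· + a) ++ u') := by
  refine le_weightedDist_iff.2 fun b c h => ?_
  obtain ⟨b₁, c₁, b₂, c₂, h₁, h₂, rfl, hc⟩ := h.exists_rewrites_small_big (a := a) <| by
    intro p hp
    simp only [List.mem_append, List.mem_map] at hp
    obtain hp | ⟨q, -, rfl⟩ := hp
    · exact (hu p hp).ne
    · omega
  obtain ⟨hs, hb, hm⟩ := small_big_append_map_add (fun p hp => p.lt_succ_self.trans (hu p hp)) v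
  obtain ⟨hs', hb', hm'⟩ := small_big_map_add_append hu' v'
  rw [hs, hs'] at h₁
  rw [hb, hb'] at h₂
  rw [hm, hm'] at hc
  grw [h₁.weightedDist_le, h₂.weightedDist_le]
  norm_cast
  nlinarith

theorem weightedDist_add_weightedDist_le (hw : ∀ p ∈ w, p + 1 ≠ a) :
    weightedDist α β w (small a w ++ (big a w).map (· + a)) +
        weightedDist α β w ((big a w).map (· + a) ++ small a w) ≤
      (β * ((small a w).length * (big a w).length) : ℕ) := by
  obtain ⟨c, hc, hcm⟩ := Rewrites.big_append_small hw
  grw [(Rewrites.small_append_big hw).weightedDist_le, hc.weightedDist_le]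
  rw [← hcm]
  norm_cast
  linarith

theorem extDiam_reducedWords_mul_shift (hσ : ∀ i, a ≤ i → σ i = i) (hx : x ∈ reducedWords σ)
    (hy : y ∈ reducedWords τ) :
    extDiam (weightedDist α β) (reducedWords (σ * shift a τ)) =
      extDiam (weightedDist α β) (reducedWords σ) + extDiam (weightedDist α β) (reducedWords τ) +
        (β * (x.length * y.length) : ℕ) := by
  have hlt {u : List ℕ} (hu : u ∈ reducedWords σ) : ∀ p ∈ u, p + 1 < a :=
    succ_lt_of_mem_reducedWords hσ hu
  have hlo (p : List ℕ × List ℕ) (hp : p ∈ reducedWords σ ×ˢ reducedWords τ) :=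
    append_map_add_mem_reducedWords hσ hp.1 hp.2
  rw [← extDiam_prod ⟨x, hx⟩ ⟨y, hy⟩]
  refine extDiam_eq_add_of_antipodal (weightedDist_comm α β) (weightedDist_triangle α β)
    (proj := fun w => (small a w, big a w)) (lo := fun p => p.1 ++ p.2.map (· + a))
    (hi := fun p => p.2.map (· + a) ++ p.1) ⟨(x, y), hx, hy⟩
    (fun w hw => small_big_mem_reducedWords hσ hw) hlo (fun p hp => ?_) (fun p _ q _ => ?_)
    (fun p _ q _ => ?_) (fun w hw => ?_) fun p hp q hq => ?_
  · have hfar := Rewrites.append_far p.1 (p.2.map (· + a)) fun j hj k hk => by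
      have := hlt hp.1 j hj
      simp only [List.mem_map] at hk
      omega
    exact ⟨(hlo p hp).1.rewrites hfar, by rw [← hfar.wordPerm_eq, (hlo p hp).2]⟩
  · grw [weightedDist_append_le, weightedDist_map_add_le]
  · grw [weightedDist_append_le, weightedDist_map_add_le, add_comm]
  · obtain ⟨hs, hb⟩ := small_big_mem_reducedWords hσ hw
    rw [length_eq_of_mem_reducedWords hx hs, length_eq_of_mem_reducedWords hy hb]
    exact weightedDist_add_weightedDist_le (succ_ne_of_mem_reducedWords_mul_shift hσ hw)
  · rw [length_eq_of_mem_reducedWords hx hq.1, length_eq_of_mem_reducedWords hy hq.2]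
    exact weightedDist_add_weightedDist_add_le (hlt hp.1) fun i hi =>
      i.lt_succ_self.trans (hlt hq.1 i hi)

end

/-! ### Deleting a strand -/

/-- The word `q + k - 1, …, q + 1, q`. -/
def desc (q : ℕ) : ℕ → List ℕ
  | 0 => []
  | k + 1 => (q + k) :: desc q k

theorem length_desc (q k : ℕ) : (desc q k).length = k := by
  induction k with
  | zero => rfl
  | succ k ih => simp [desc, ih]

theorem mem_desc {q k p : ℕ} : p ∈ desc q k ↔ q ≤ p ∧ p < q + k := by
  induction k with
  | zero => simp [desc]
  | succ k ih => simp only [desc, List.mem_cons, ih]; omega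

theorem desc_add (q i j : ℕ) : desc q (i + j) = desc (q + i) j ++ desc q i := by
  induction j with
  | zero => rfl
  | succ j ih => simp [desc, ← Nat.add_assoc, ih]

theorem map_add_desc (q k a : ℕ) : (desc q k).map (· + a) = desc (q + a) k := by
  induction k with
  | zero => rfl
  | succ k ih => rw [desc, desc, List.map_cons, ih, Nat.add_right_comm]

theorem wordPerm_desc_of_lt {q k x : ℕ} (h : x < q) : wordPerm (desc q k) x = x := by
  induction k with
  | zero => rfl
  | succ k ih => rw [desc, wordPerm_cons_apply, ih, if_neg (by omega), if_neg (by omega)]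

theorem wordPerm_desc_self (q k : ℕ) : wordPerm (desc q k) q = q + k := by
  induction k with
  | zero => rfl
  | succ k ih => rw [desc, wordPerm_cons_apply, ih, if_pos rfl, Nat.add_assoc]

theorem wordPerm_desc_succ {q k x : ℕ} (h : q ≤ x) (hx : x < q + k) :
    wordPerm (desc q k) (x + 1) = x := by
  induction k with
  | zero => omega
  | succ k ih =>
    rw [desc, wordPerm_cons_apply]
    rcases (show x < q + k ∨ x = q + k by omega) with hlt | rfl
    · rw [ih hlt, if_neg (by omega), if_neg (by omega)]
    · rw [wordPerm_of_le (n := q + k + 1) (by simp [mem_desc]) le_rfl]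
      simp

theorem Rewrites.desc_far {q k p : ℕ} (h : p + 1 < q ∨ q + k < p) :
    Rewrites 0 k (desc q k ++ [p]) (p :: desc q k) := by
  have hfar := Rewrites.cons_far (p := p) (desc q k) fun x hx => by
    rw [mem_desc] at hx
    omega
  rw [length_desc] at hfar
  exact hfar.symm

theorem Rewrites.desc_braid (q i j : ℕ) :
    Rewrites 1 (i + j) (desc q (i + 2 + j) ++ [q + i + 1]) ((q + i) :: desc q (i + 2 + j)) := by
  have hdesc : desc q (i + 2 + j) = desc (q + i + 2) j ++ [q + i + 1, q + i] ++ desc q i := by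
    rw [desc_add, desc_add q i 2]
    simp [desc, Nat.add_assoc]
  have hlow : Rewrites 0 i (desc q i ++ [q + i + 1]) ((q + i + 1) :: desc q i) :=
    .desc_far (by omega)
  have hmid : Rewrites 1 0 [q + i + 1, q + i, q + i + 1] [q + i, q + i + 1, q + i] :=
    .of_braid ⟨[], [], q + i, Or.inr ⟨rfl, rfl⟩⟩
  have hhigh : Rewrites 0 j (desc (q + i + 2) j ++ [q + i]) ((q + i) :: desc (q + i + 2) j) :=
    .desc_far (by omega)
  have hall := ((hlow.append_left (desc (q + i + 2) j ++ [q + i + 1, q + i])).trans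
    (by simpa using hmid.append (desc (q + i + 2) j) (desc q i))).trans
    (by simpa using hhigh.append_right ([q + i + 1, q + i] ++ desc q i))
  rw [hdesc]
  simpa using hall

/-- The letter of a word that becomes `p` once the strand at position `q` is deleted. -/
def skip (q p : ℕ) : ℕ := if p < q then p else p + 1

theorem skip_of_lt {q p : ℕ} (h : p < q) : skip q p = p := if_pos h

theorem skip_of_le {q p : ℕ} (h : q ≤ p) : skip q p = p + 1 := if_neg h.not_gt

theorem Rewrites.desc_skip {a k p : ℕ} (ha : p + 1 ≠ a) (hak : p + 1 ≠ a + k) :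
    ∃ b c, Rewrites b c (desc a k ++ [skip a p]) (skip (a + k) p :: desc a k) ∧
      b + (if a + k ≤ p then 1 else 0) = (if a ≤ p then 1 else 0) ∧
      c + (if a ≤ p then a + 2 else a) = (if a + k ≤ p then a + k + 2 else a + k) := by
  rcases lt_or_ge p a with hpa | hpa
  · rw [skip_of_lt hpa, skip_of_lt (by omega)]
    exact ⟨0, k, .desc_far (by omega), by grind, by grind⟩
  rcases lt_or_ge p (a + k) with hpk | hpk
  · rw [skip_of_le hpa, skip_of_lt hpk]
    obtain ⟨i, rfl⟩ := Nat.exists_eq_add_of_le hpa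
    obtain ⟨j, rfl⟩ : ∃ j, k = i + 2 + j := Nat.exists_eq_add_of_le (by omega)
    exact ⟨1, i + j, .desc_braid a i j, by grind, by grind⟩
  · rw [skip_of_le hpa, skip_of_le hpk]
    exact ⟨0, k, .desc_far (by omega), by grind, by grind⟩

/-- The strand that is at position `q` before the word `w` never moves to the right. -/
def MovesLeft : ℕ → List ℕ → Prop
  | _, [] => True
  | q, p :: w => p ≠ q ∧ MovesLeft (if p + 1 = q then p else q) w

/-- The position after the word `w` of the strand that is at position `q` before it, provided that
the strand never moves to the right. -/
def dest : ℕ → List ℕ → ℕ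
  | q, [] => q
  | q, p :: w => dest (if p + 1 = q then p else q) w

/-- The letters of `w` that do not move the strand starting at position `q`, each as a pair of the
current position of the strand and the letter that remains once the strand is deleted. -/
def trace : ℕ → List ℕ → List (ℕ × ℕ)
  | _, [] => []
  | q, p :: w =>
    if p + 1 = q then trace p w else (q, if p < q then p else p - 1) :: trace q w

/-- The word that remains of `w` once the strand starting at position `q` is deleted. -/
def del (q : ℕ) (w : List ℕ) : List ℕ := (trace q w).map Prod.snd

/-- The number of letters in a trace that lie to the right of the strand. -/
def braidWeight (t : List (ℕ × ℕ)) : ℕ := t.countP fun x => x.1 ≤ x.2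

/-- The sum of the positions of the strand in a trace, where letters to the right of the strand
count `2` more. A commutation move changes it by at most `1`, a long braid move leaves it
unchanged. -/
def commWeight (t : List (ℕ × ℕ)) : ℕ := (t.map fun x => if x.1 ≤ x.2 then x.1 + 2 else x.1).sum

section

variable {q p : ℕ} {w : List ℕ}

theorem dest_cross (p : ℕ) (w : List ℕ) : dest (p + 1) (p :: w) = dest p w := by simp [dest]

theorem trace_cross (p : ℕ) (w : List ℕ) : trace (p + 1) (p :: w) = trace p w := by simp [trace]

theorem skip_ne (q p : ℕ) : skip q p ≠ q := by grind [skip]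

theorem skip_add_one_ne (h : p + 1 ≠ q) : skip q p + 1 ≠ q := by grind [skip]

theorem exists_skip_eq (hpq : p ≠ q) (hp : p + 1 ≠ q) : ∃ p', p' + 1 ≠ q ∧ skip q p' = p := by
  rcases lt_or_ge p q with hlt | hle
  · exact ⟨p, hp, skip_of_lt hlt⟩
  · exact ⟨p - 1, by omega, by grind [skip]⟩

theorem dest_pass (h : p + 1 ≠ q) (w : List ℕ) : dest q (skip q p :: w) = dest q w := by
  rw [dest, if_neg (skip_add_one_ne h)]

theorem trace_pass (h : p + 1 ≠ q) (w : List ℕ) :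
    trace q (skip q p :: w) = (q, p) :: trace q w := by
  have hskip : (if skip q p < q then skip q p else skip q p - 1) = p := by grind [skip]
  rw [trace, if_neg (skip_add_one_ne h), hskip]

theorem del_cross (p : ℕ) (w : List ℕ) : del (p + 1) (p :: w) = del p w := by
  rw [del, trace_cross, del]

theorem del_pass (h : p + 1 ≠ q) (w : List ℕ) : del q (skip q p :: w) = p :: del q w := by
  rw [del, trace_pass h, List.map_cons, del]

theorem braidWeight_cons (q p : ℕ) (t : List (ℕ × ℕ)) :
    braidWeight ((q, p) :: t) = (if q ≤ p then 1 else 0) + braidWeight t := by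
  simp [braidWeight, List.countP_cons, Nat.add_comm]

theorem commWeight_cons (q p : ℕ) (t : List (ℕ × ℕ)) :
    commWeight ((q, p) :: t) = (if q ≤ p then q + 2 else q) + commWeight t := by
  simp [commWeight]

theorem movesLeft_cross {p : ℕ} {w : List ℕ} (h : MovesLeft p w) : MovesLeft (p + 1) (p :: w) :=
  ⟨p.succ_ne_self.symm, by rwa [if_pos rfl]⟩

theorem movesLeft_pass (hp : p + 1 ≠ q) (h : MovesLeft q w) : MovesLeft q (skip q p :: w) :=
  ⟨skip_ne q p, by rwa [if_neg (skip_add_one_ne hp)]⟩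

theorem MovesLeft.induction {motive : ∀ q w, MovesLeft q w → Prop}
    (nil : ∀ q, motive q [] trivial)
    (cross : ∀ p w h, motive p w h → motive (p + 1) (p :: w) (movesLeft_cross h))
    (pass : ∀ q p w hp h, motive q w h → motive q (skip q p :: w) (movesLeft_pass hp h))
    (h : MovesLeft q w) : motive q w h := by
  induction w generalizing q with
  | nil => exact nil q
  | cons p w ih =>
    obtain ⟨hpq, hw⟩ := id h
    split_ifs at hw with hp
    · subst hp
      exact cross p w hw (ih hw)
    · obtain ⟨p', hp', rfl⟩ := exists_skip_eq hpq hp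
      exact pass q p' w hp' hw (ih hw)

theorem MovesLeft.dest_le (h : MovesLeft q w) : dest q w ≤ q := by
  induction h using MovesLeft.induction with
  | nil q => exact le_rfl
  | cross p w _ ih => rw [dest_cross]; omega
  | pass q p w hp _ ih => rwa [dest_pass hp]

theorem MovesLeft.wordPerm_dest (h : MovesLeft q w) : wordPerm w (dest q w) = q := by
  induction h using MovesLeft.induction with
  | nil q => rfl
  | cross p w _ ih => rw [dest_cross, wordPerm_cons_apply, ih, if_pos rfl]
  | pass q p w hp _ ih =>
    rw [dest_pass hp, wordPerm_cons_apply, ih, if_neg (skip_ne q p).symm,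
      if_neg (skip_add_one_ne hp).symm]

theorem MovesLeft.succ_lt_of_mem_del {n : ℕ} (h : MovesLeft q w) (hq : q ≤ n)
    (hw : ∀ p ∈ w, p < n) : ∀ p ∈ del q w, p + 1 < n := by
  induction h using MovesLeft.induction with
  | nil q => simp [del, trace]
  | cross p w _ ih =>
    simp only [List.mem_cons, forall_eq_or_imp] at hw
    simpa only [del_cross] using ih hw.1.le hw.2
  | pass q p w hp _ ih =>
    simp only [List.mem_cons, forall_eq_or_imp] at hw
    simp only [del_pass hp, List.mem_cons, forall_eq_or_imp]
    exact ⟨by grind [skip], ih hq hw.2⟩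

theorem MovesLeft.rewrites_del_append_desc {k : ℕ} (h : MovesLeft q w)
    (hw : ∀ p ∈ w, p < q + k) :
    ∃ c, Rewrites (braidWeight (trace q w)) c (desc q k ++ w)
        (del q w ++ desc (dest q w) (q + k - dest q w)) ∧
      c + commWeight (trace q w) = (q + k) * (del q w).length := by
  induction h using MovesLeft.induction generalizing k with
  | nil q => exact ⟨0, by simpa [trace, del, dest, braidWeight] using Rewrites.refl (desc q k), rfl⟩
  | cross p w _ ih =>
    simp only [List.mem_cons, forall_eq_or_imp] at hw
    have hdesc : desc p (1 + k) = desc (p + 1) k ++ [p] := desc_add p 1 k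
    simpa only [del_cross, dest_cross, trace_cross, hdesc, List.append_assoc, List.singleton_append,
      ← Nat.add_assoc] using ih (k := 1 + k) (by simpa only [← Nat.add_assoc] using hw.2)
  | pass q p w hp _ ih =>
    simp only [List.mem_cons, forall_eq_or_imp] at hw
    have hpk : p + 1 < q + k := by grind [skip]
    obtain ⟨c, hc, hcw⟩ := ih hw.2
    obtain ⟨b₀, c₀, h₀, hb₀, hc₀⟩ := Rewrites.desc_skip hp hpk.ne
    have hpk' : ¬ q + k ≤ p := by omega
    rw [skip_of_lt (show p < q + k by omega)] at h₀
    simp only [if_neg hpk', Nat.add_zero] at hb₀ hc₀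
    simp only [del_pass hp, dest_pass hp, trace_pass hp, braidWeight_cons, commWeight_cons,
      List.length_cons]
    exact ⟨c₀ + c, by simpa [hb₀] using (h₀.append_right w).trans (hc.cons p), by linarith⟩

theorem MovesLeft.rewrites_desc_append {a : ℕ} (h : MovesLeft q w) (ha : dest q w = a)
    (hw : ∀ p ∈ del q w, p + 1 ≠ a) :
    ∃ b c, Rewrites b c w (desc a (q - a) ++ (del q w).map (skip a)) ∧
      b + braidWeight (trace q w) = (del q w).countP (a ≤ ·) ∧
      c + a * (del q w).length + 2 * (del q w).countP (a ≤ ·) = commWeight (trace q w) := by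
  induction h using MovesLeft.induction with
  | nil q =>
    subst ha
    refine ⟨0, 0, ?_, rfl, rfl⟩
    simpa [dest, del, trace, desc] using Rewrites.refl []
  | cross p w h ih =>
    rw [dest_cross] at ha
    rw [del_cross] at hw
    obtain ⟨b, c, hbc, hb, hc⟩ := ih ha hw
    have hap : a ≤ p := ha ▸ h.dest_le
    have hdesc : desc a (p + 1 - a) = p :: desc a (p - a) := by
      rw [Nat.sub_add_comm hap, desc, Nat.add_sub_cancel' hap]
    rw [del_cross, trace_cross, hdesc]
    exact ⟨b, c, hbc.cons p, hb, hc⟩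
  | pass q p w hp h ih =>
    rw [dest_pass hp] at ha
    simp only [del_pass hp, List.mem_cons, forall_eq_or_imp] at hw
    obtain ⟨b, c, hbc, hb, hc⟩ := ih ha hw.2
    have hqa : a + (q - a) = q := Nat.add_sub_cancel' (ha ▸ h.dest_le)
    obtain ⟨b₀, c₀, h₀, hb₀, hc₀⟩ := Rewrites.desc_skip (k := q - a) hw.1 (by rwa [hqa])
    rw [hqa] at h₀ hb₀ hc₀
    simp only [del_pass hp, trace_pass hp, braidWeight_cons, commWeight_cons, List.length_cons,
      List.countP_cons, decide_eq_true_eq]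
    refine ⟨b + b₀, c + c₀, ?_, by omega, ?_⟩
    · simpa using (hbc.cons (skip q p)).trans (h₀.symm.append_right _)
    · rw [Nat.mul_add]
      split_ifs at * <;> omega

end

section

variable {q : ℕ} {u v w x y : List ℕ}

theorem movesLeft_append : MovesLeft q (x ++ y) ↔ MovesLeft q x ∧ MovesLeft (dest q x) y := by
  induction x generalizing q with
  | nil => simp [MovesLeft, dest]
  | cons p x ih => simp [MovesLeft, dest, ih, and_assoc]

theorem trace_append (q : ℕ) (x y : List ℕ) :
    trace q (x ++ y) = trace q x ++ trace (dest q x) y := by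
  induction x generalizing q with
  | nil => rfl
  | cons p x ih =>
    rw [List.cons_append, trace, trace, dest]
    split_ifs <;> simp [ih]

theorem braidWeight_append (s t : List (ℕ × ℕ)) :
    braidWeight (s ++ t) = braidWeight s + braidWeight t := List.countP_append

theorem commWeight_append (s t : List (ℕ × ℕ)) :
    commWeight (s ++ t) = commWeight s + commWeight t := by
  simp [commWeight]

theorem del_append (q : ℕ) (x y : List ℕ) : del q (x ++ y) = del q x ++ del (dest q x) y := by
  rw [del, trace_append, List.map_append, del, del]

theorem dest_append (q : ℕ) (x y : List ℕ) : dest q (x ++ y) = dest (dest q x) y := by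
  induction x generalizing q with
  | nil => rfl
  | cons p _ ih => exact ih _

/-- The word `v` is an admissible successor of `u` under `b` long braid moves and `c` commutation
moves once the strand at position `q` is deleted: the moves that do not become trivial rewrite
`del q u` to `del q v`, and their number is controlled by the change of the weights. -/
def DelRewrites (q b c : ℕ) (u v : List ℕ) : Prop :=
  MovesLeft q v ∧ dest q u = dest q v ∧ ∃ b' c', Rewrites b' c' (del q u) (del q v) ∧
    b' + braidWeight (trace q v) ≤ b + braidWeight (trace q u) ∧
    c' + commWeight (trace q u) ≤ c + commWeight (trace q v)

theorem DelRewrites.trans {b₁ c₁ b₂ c₂ : ℕ} (h₁ : DelRewrites q b₁ c₁ u v)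
    (h₂ : DelRewrites q b₂ c₂ v w) : DelRewrites q (b₁ + b₂) (c₁ + c₂) u w := by
  obtain ⟨-, hd₁, b₁', c₁', hr₁, hb₁, hc₁⟩ := h₁
  obtain ⟨hw, hd₂, b₂', c₂', hr₂, hb₂, hc₂⟩ := h₂
  exact ⟨hw, hd₁.trans hd₂, _, _, hr₁.trans hr₂, by omega, by omega⟩

theorem DelRewrites.append {b c : ℕ} (hx : MovesLeft q (x ++ u ++ y))
    (h : DelRewrites (dest q x) b c u v) : DelRewrites q b c (x ++ u ++ y) (x ++ v ++ y) := by
  obtain ⟨hv, hd, b', c', hr, hb, hc⟩ := h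
  simp only [movesLeft_append, dest_append] at hx
  refine ⟨?_, ?_, b', c', ?_, ?_, ?_⟩
  · simp only [movesLeft_append, dest_append]
    exact ⟨⟨hx.1.1, hv⟩, hd ▸ hx.2⟩
  · simp only [dest_append, hd]
  · simpa only [del_append, dest_append, hd] using hr.append _ _
  · simp only [trace_append, braidWeight_append, dest_append, hd]
    omega
  · simp only [trace_append, commWeight_append, dest_append, hd]
    omega

theorem delRewrites_comm {j k : ℕ} (hjk : j + 1 < k ∨ k + 1 < j) (h : MovesLeft q [j, k]) :
    DelRewrites q 0 1 [j, k] [k, j] := by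
  simp only [MovesLeft] at h
  have hdest : MovesLeft q [k, j] ∧ dest q [j, k] = dest q [k, j] := by
    simp only [MovesLeft, dest]
    grind
  refine ⟨hdest.1, hdest.2, ?_⟩
  by_cases hcross : j + 1 = q ∨ k + 1 = q
  · have hdel : del q [j, k] = del q [k, j] := by
      simp only [del, trace]
      grind
    refine ⟨0, 0, hdel ▸ .refl _, ?_, ?_⟩ <;> simp only [trace] <;>
      grind [braidWeight_cons, commWeight_cons]
  · obtain ⟨j, hj, rfl⟩ := exists_skip_eq h.1 (by tauto)
    obtain ⟨k, hk, rfl⟩ := exists_skip_eq (q := q) (p := k) (by grind) (by tauto)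
    simp only [del_pass hj, del_pass hk, trace_pass hj, trace_pass hk, braidWeight_cons,
      commWeight_cons]
    exact ⟨0, 1, .of_comm ⟨[], [], j, k, by grind [skip], rfl, rfl⟩, by omega, by omega⟩

theorem delRewrites_braid {j i : ℕ} (hij : i = j + 1 ∨ j = i + 1) (h : MovesLeft q [j, i, j]) :
    DelRewrites q 1 0 [j, i, j] [i, j, i] := by
  simp only [MovesLeft] at h
  have hdest : MovesLeft q [i, j, i] ∧ dest q [j, i, j] = dest q [i, j, i] := by
    simp only [MovesLeft, dest]
    grind
  refine ⟨hdest.1, hdest.2, ?_⟩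
  by_cases hcross : j + 1 = q ∨ i + 1 = q
  · have hdel : del q [j, i, j] = del q [i, j, i] := by
      simp only [del, trace]
      grind
    refine ⟨0, 0, hdel ▸ .refl _, ?_, ?_⟩ <;> simp only [trace] <;>
      grind [braidWeight_cons, commWeight_cons]
  · obtain ⟨j, hj, rfl⟩ := exists_skip_eq h.1 (by tauto)
    obtain ⟨i, hi, rfl⟩ := exists_skip_eq (q := q) (p := i) (by grind) (by tauto)
    have hbraid : LongBraidMove [j, i, j] [i, j, i] := by
      obtain rfl | rfl : i = j + 1 ∨ j = i + 1 := by grind [skip]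
      · exact ⟨[], [], j, .inl ⟨rfl, rfl⟩⟩
      · exact ⟨[], [], i, .inr ⟨rfl, rfl⟩⟩
    simp only [del_pass hj, del_pass hi, trace_pass hj, trace_pass hi, braidWeight_cons,
      commWeight_cons]
    exact ⟨1, 0, .of_braid hbraid, by grind [skip], by grind [skip]⟩

theorem CommutationMove.delRewrites (h : CommutationMove u v) (hu : MovesLeft q u) :
    DelRewrites q 0 1 u v := by
  obtain ⟨x, y, j, k, hjk, rfl, rfl⟩ := h
  refine .append hu (delRewrites_comm hjk ?_)
  rw [movesLeft_append, movesLeft_append] at hu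
  exact hu.1.2

theorem LongBraidMove.delRewrites (h : LongBraidMove u v) (hu : MovesLeft q u) :
    DelRewrites q 1 0 u v := by
  obtain ⟨x, y, j, ⟨rfl, rfl⟩ | ⟨rfl, rfl⟩⟩ := h <;> refine .append hu (delRewrites_braid ?_ ?_)
  · exact .inl rfl
  · rw [movesLeft_append, movesLeft_append] at hu
    exact hu.1.2
  · exact .inr rfl
  · rw [movesLeft_append, movesLeft_append] at hu
    exact hu.1.2

theorem Rewrites.delRewrites {b c : ℕ} (h : Rewrites b c u v) (hu : MovesLeft q u) :
    DelRewrites q b c u v := by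
  induction h with
  | refl w => exact ⟨hu, rfl, 0, 0, .refl _, le_rfl, le_rfl⟩
  | comm hm _ ih =>
    have h₁ := hm.delRewrites hu
    simpa only [Nat.zero_add, Nat.add_comm 1] using h₁.trans (ih h₁.1)
  | braid hm _ ih =>
    have h₁ := hm.delRewrites hu
    simpa only [Nat.zero_add, Nat.add_comm 1] using h₁.trans (ih h₁.1)

end

/-! ### Deleting a strand from the reduced words of a permutation -/

section

variable {a n q r : ℕ} {u v w y : List ℕ}

theorem IsReduced.movesLeft {i : ℕ} (h : IsReduced w) (hi : wordPerm w i = q)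
    (hle : ∀ j ≤ i, wordPerm w j ≤ q) : MovesLeft q w := by
  induction w generalizing q with
  | nil => trivial
  | cons p w ih =>
    have hval {x y : ℕ} (hxy : wordPerm w x = y) : x = (wordPerm w).symm y := by
      rw [← hxy, Equiv.symm_apply_apply]
    have hsymm {x y : ℕ} (hx : wordPerm w x = p) (hy : wordPerm w y = p + 1) : x < y := by
      rw [hval hx, hval hy]
      exact h.symm_lt_symm
    simp only [wordPerm_cons_apply] at hi hle
    have hpq : p ≠ q := by
      rintro rfl
      have hlt := hsymm (Equiv.apply_symm_apply _ p) (show wordPerm w i = p + 1 by grind)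
      simpa using hle _ hlt.le
    refine ⟨hpq, ih h.of_cons (by grind) fun j hj => ?_⟩
    have hj' := hle j hj
    by_cases hpq' : p + 1 = q
    · have hj'' : wordPerm w j ≠ p + 1 := fun hjp =>
        (hsymm (show wordPerm w i = p by grind) hjp).not_ge hj
      grind
    · grind

theorem IsReduced.movesLeft_of_lt (h : IsReduced w) (hw : ∀ p ∈ w, p < n) : MovesLeft n w := by
  have hlt (x : ℕ) : wordPerm w x < n + 1 ↔ x < n + 1 :=
    wordPerm_lt_iff (fun p hp => by have := hw p hp; omega) x
  refine h.movesLeft (Equiv.apply_symm_apply _ n) fun j hj => ?_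
  have hn : (wordPerm w).symm n < n + 1 := by
    rw [← hlt, Equiv.apply_symm_apply]
    exact n.lt_succ_self
  exact Nat.lt_succ_iff.1 ((hlt j).2 (hj.trans_lt hn))

/-- Matsumoto's theorem for words in the letters `< n`. -/
theorem exists_rewrites_of_lt {n : ℕ} {u v : List ℕ} (hu : IsReduced u) (hv : IsReduced v)
    (h : wordPerm u = wordPerm v) (hun : ∀ p ∈ u, p < n) (hvn : ∀ p ∈ v, p < n) :
    ∃ b c, Rewrites b c u v := by
  induction n generalizing u v with
  | zero =>
    rw [List.eq_nil_iff_forall_not_mem.2 fun p hp => (hun p hp).not_ge p.zero_le,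
      List.eq_nil_iff_forall_not_mem.2 fun p hp => (hvn p hp).not_ge p.zero_le]
    exact ⟨0, 0, .refl _⟩
  | succ n ih =>
    have hmu := hu.movesLeft_of_lt hun
    have hmv := hv.movesLeft_of_lt hvn
    have hdest : dest (n + 1) u = dest (n + 1) v := by
      rw [← (wordPerm u).injective.eq_iff, hmu.wordPerm_dest, h, hmv.wordPerm_dest]
    obtain ⟨c₁, h₁, -⟩ := hmu.rewrites_del_append_desc (k := 0) hun
    obtain ⟨c₂, h₂, -⟩ := hmv.rewrites_del_append_desc (k := 0) hvn
    simp only [desc, List.nil_append, ← hdest] at h₁ h₂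
    have hperm : wordPerm (del (n + 1) u) = wordPerm (del (n + 1) v) := by
      rw [h₁.wordPerm_eq, h₂.wordPerm_eq, wordPerm_append, wordPerm_append] at h
      exact mul_right_cancel h
    have hlt {w : List ℕ} (hw : MovesLeft (n + 1) w) (hwn : ∀ p ∈ w, p < n + 1) :
        ∀ p ∈ del (n + 1) w, p < n := fun p hp =>
      Nat.succ_lt_succ_iff.1 (hw.succ_lt_of_mem_del le_rfl hwn p hp)
    obtain ⟨b, c, hbc⟩ := ih (hu.rewrites h₁).of_append_left (hv.rewrites h₂).of_append_left hperm
      (hlt hmu hun) (hlt hmv hvn)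
    exact ⟨_, _, (h₁.trans (hbc.append_right _)).trans h₂.symm⟩

/-- Matsumoto's theorem. -/
theorem exists_rewrites {σ : Equiv.Perm ℕ} (hu : u ∈ reducedWords σ) (hv : v ∈ reducedWords σ) :
    ∃ b c, Rewrites b c u v := by
  obtain ⟨n, hn⟩ := (u ++ v).toFinset.exists_nat_subset_range
  have hlt (p : ℕ) (hp : p ∈ u ∨ p ∈ v) : p < n := by simpa using hn (by simpa using hp)
  exact exists_rewrites_of_lt hu.1 hv.1 (hu.2.trans hv.2.symm) (fun p hp => hlt p (.inl hp))
    fun p hp => hlt p (.inr hp)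

theorem trace_map_skip (h : ∀ p ∈ w, p + 1 ≠ q) : trace q (w.map (skip q)) = w.map (Prod.mk q) := by
  induction w with
  | nil => rfl
  | cons p w ih =>
    simp only [List.mem_cons, forall_eq_or_imp] at h
    rw [List.map_cons, trace_pass h.1, ih h.2, List.map_cons]

theorem dest_map_skip (h : ∀ p ∈ w, p + 1 ≠ q) : dest q (w.map (skip q)) = q := by
  induction w with
  | nil => rfl
  | cons p w ih =>
    simp only [List.mem_cons, forall_eq_or_imp] at h
    rw [List.map_cons, dest_pass h.1, ih h.2]

theorem trace_desc (a r : ℕ) : trace (a + r) (desc a r) = [] := by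
  induction r with
  | zero => rfl
  | succ r ih => rw [desc, ← Nat.add_assoc, trace_cross, ih]

theorem dest_desc (a r : ℕ) : dest (a + r) (desc a r) = a := by
  induction r with
  | zero => rfl
  | succ r ih => rw [desc, ← Nat.add_assoc, dest_cross, ih]

theorem map_skip_of_lt (h : ∀ p ∈ w, p < q) : w.map (skip q) = w :=
  (List.map_congr_left fun p hp => skip_of_lt (h p hp)).trans w.map_id

theorem trace_append_desc (h : ∀ p ∈ y, p + 1 < a + r) :
    trace (a + r) (y ++ desc a r) = y.map (Prod.mk (a + r)) := by
  have hne : ∀ p ∈ y, p + 1 ≠ a + r := fun p hp => (h p hp).ne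
  have hskip := map_skip_of_lt fun p hp => (Nat.lt_succ_self p).trans (h p hp)
  have htrace := trace_map_skip hne
  have hdest := dest_map_skip hne
  rw [hskip] at htrace hdest
  rw [trace_append, htrace, hdest, trace_desc, List.append_nil]

theorem trace_desc_append (h : ∀ p ∈ y, p + 1 ≠ a) :
    trace (a + r) (desc a r ++ y.map (skip a)) = y.map (Prod.mk a) := by
  rw [trace_append, trace_desc, dest_desc, trace_map_skip h, List.nil_append]

theorem braidWeight_map_mk (q : ℕ) (w : List ℕ) :
    braidWeight (w.map (Prod.mk q)) = w.countP (q ≤ ·) := by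
  simp [braidWeight, List.countP_map, Function.comp_def]

theorem commWeight_map_mk (q : ℕ) (w : List ℕ) :
    commWeight (w.map (Prod.mk q)) = q * w.length + 2 * w.countP (q ≤ ·) := by
  induction w with
  | nil => rfl
  | cons p w ih =>
    rw [List.map_cons, commWeight_cons, ih, List.length_cons, List.countP_cons]
    simp only [decide_eq_true_eq]
    split_ifs <;> ring

variable {ρ : Equiv.Perm ℕ}

theorem mul_wordPerm_desc_apply_of_lt (hρ : ∀ x, a + r ≤ x → ρ x = x) {x : ℕ} (hx : a + r < x) :
    (ρ * wordPerm (desc a r)) x = x := by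
  rw [Equiv.Perm.mul_apply, wordPerm_of_le (n := a + r + 1) (by simp [mem_desc]) hx, hρ x hx.le]

theorem movesLeft_of_mem_reducedWords_mul_desc (hρ : ∀ x, a + r ≤ x → ρ x = x)
    (hw : w ∈ reducedWords (ρ * wordPerm (desc a r))) : MovesLeft (a + r) w :=
  hw.1.movesLeft_of_lt fun p hp => Nat.succ_lt_succ_iff.1 <|
    succ_lt_of_mem_reducedWords (fun _ hx => mul_wordPerm_desc_apply_of_lt hρ hx) hw p hp

theorem dest_of_mem_reducedWords_mul_desc (hρ : ∀ x, a + r ≤ x → ρ x = x)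
    (hw : w ∈ reducedWords (ρ * wordPerm (desc a r))) : dest (a + r) w = a := by
  rw [← (wordPerm w).injective.eq_iff, (movesLeft_of_mem_reducedWords_mul_desc hρ hw).wordPerm_dest,
    hw.2, Equiv.Perm.mul_apply, wordPerm_desc_self, hρ _ le_rfl]

theorem exists_rewrites_del_append_desc (hρ : ∀ x, a + r ≤ x → ρ x = x)
    (hw : w ∈ reducedWords (ρ * wordPerm (desc a r))) :
    ∃ c, Rewrites (braidWeight (trace (a + r) w)) c w (del (a + r) w ++ desc a r) ∧
      c + commWeight (trace (a + r) w) = (a + r) * (del (a + r) w).length := by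
  have hlt : ∀ p ∈ w, p < a + r + 0 := fun p hp => Nat.succ_lt_succ_iff.1 <|
    succ_lt_of_mem_reducedWords (fun _ hx => mul_wordPerm_desc_apply_of_lt hρ hx) hw p hp
  have h := (movesLeft_of_mem_reducedWords_mul_desc hρ hw).rewrites_del_append_desc hlt
  rwa [dest_of_mem_reducedWords_mul_desc hρ hw, Nat.add_zero, Nat.add_sub_cancel_left] at h

theorem del_mem_reducedWords (hρ : ∀ x, a + r ≤ x → ρ x = x)
    (hw : w ∈ reducedWords (ρ * wordPerm (desc a r))) : del (a + r) w ∈ reducedWords ρ := by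
  obtain ⟨c, h, -⟩ := exists_rewrites_del_append_desc hρ hw
  refine ⟨(hw.1.rewrites h).of_append_left, ?_⟩
  have hperm := h.wordPerm_eq
  rw [hw.2, wordPerm_append] at hperm
  exact (mul_right_cancel hperm).symm

theorem append_desc_mem_reducedWords (hρ : ∀ x, a + r ≤ x → ρ x = x) (hy : y ∈ reducedWords ρ) :
    y ++ desc a r ∈ reducedWords (ρ * wordPerm (desc a r)) := by
  have hperm : wordPerm (y ++ desc a r) = ρ * wordPerm (desc a r) := by rw [wordPerm_append, hy.2]
  obtain ⟨w, hw⟩ := nonempty_reducedWords_wordPerm (y ++ desc a r)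
  rw [hperm] at hw
  obtain ⟨c, h, -⟩ := exists_rewrites_del_append_desc hρ hw
  refine ⟨hw.1.of_length_le (hperm.trans hw.2.symm) ?_, hperm⟩
  rw [h.length_eq, List.length_append, List.length_append,
    length_eq_of_mem_reducedWords hy (del_mem_reducedWords hρ hw)]

theorem del_append_desc (h : ∀ p ∈ y, p + 1 < a + r) : del (a + r) (y ++ desc a r) = y := by
  simp [del, trace_append_desc h]

theorem del_desc_append (h : ∀ p ∈ y, p + 1 ≠ a) :
    del (a + r) (desc a r ++ y.map (skip a)) = y := by
  simp [del, trace_desc_append h]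

theorem exists_rewrites_desc_append_del (hρ : ∀ x, a + r ≤ x → ρ x = x)
    (ha : ∀ y ∈ reducedWords ρ, ∀ p ∈ y, p + 1 ≠ a)
    (hw : w ∈ reducedWords (ρ * wordPerm (desc a r))) :
    ∃ b c, Rewrites b c w (desc a r ++ (del (a + r) w).map (skip a)) ∧
      b + braidWeight (trace (a + r) w) = (del (a + r) w).countP (a ≤ ·) ∧
      c + a * (del (a + r) w).length + 2 * (del (a + r) w).countP (a ≤ ·) =
        commWeight (trace (a + r) w) := by
  simpa only [Nat.add_sub_cancel_left] using
    (movesLeft_of_mem_reducedWords_mul_desc hρ hw).rewrites_desc_append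
      (dest_of_mem_reducedWords_mul_desc hρ hw) (ha _ (del_mem_reducedWords hρ hw))

theorem desc_append_mem_reducedWords (hρ : ∀ x, a + r ≤ x → ρ x = x)
    (ha : ∀ y ∈ reducedWords ρ, ∀ p ∈ y, p + 1 ≠ a) (hy : y ∈ reducedWords ρ) :
    desc a r ++ y.map (skip a) ∈ reducedWords (ρ * wordPerm (desc a r)) := by
  have hlo := append_desc_mem_reducedWords hρ hy
  obtain ⟨b, c, h, -⟩ := exists_rewrites_desc_append_del hρ ha hlo
  rw [del_append_desc (succ_lt_of_mem_reducedWords hρ hy)] at h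
  exact ⟨hlo.1.rewrites h, h.wordPerm_eq.symm.trans hlo.2⟩

theorem two_mul_countP_le (hρ : ∀ x, a + r ≤ x → ρ x = x)
    (ha : ∀ y ∈ reducedWords ρ, ∀ p ∈ y, p + 1 ≠ a) (hy : y ∈ reducedWords ρ) :
    2 * y.countP (a ≤ ·) ≤ r * y.length := by
  have hlo := append_desc_mem_reducedWords hρ hy
  obtain ⟨c₁, -, hc₁⟩ := exists_rewrites_del_append_desc hρ hlo
  obtain ⟨b₂, c₂, -, -, hc₂⟩ := exists_rewrites_desc_append_del hρ ha hlo
  rw [del_append_desc (succ_lt_of_mem_reducedWords hρ hy)] at hc₁ hc₂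
  linarith

theorem Rewrites.map_skip {b c : ℕ} (h : Rewrites b c u v) (ha : ∀ p ∈ u, p + 1 ≠ a) :
    Rewrites b c (u.map (skip a)) (v.map (skip a)) :=
  h.map (fun j k hjk => by grind [skip]) fun j hj _ => by
    have hja := ha j hj
    grind [skip]

section

variable {α β k l m : ℕ}

theorem weightedDist_append_desc_add_weightedDist_desc_append_le
    (hρ : ∀ x, a + r ≤ x → ρ x = x) (ha : ∀ y ∈ reducedWords ρ, ∀ p ∈ y, p + 1 ≠ a)
    (hl : ∀ y ∈ reducedWords ρ, y.length = l) (hk : ∀ y ∈ reducedWords ρ, y.countP (a ≤ ·) = k)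
    (hm : m + 2 * k = r * l) (hw : w ∈ reducedWords (ρ * wordPerm (desc a r))) :
    weightedDist α β w (del (a + r) w ++ desc a r) +
      weightedDist α β w (desc a r ++ (del (a + r) w).map (skip a)) ≤ (α * k + β * m : ℕ) := by
  have hdel := del_mem_reducedWords hρ hw
  obtain ⟨c₁, h₁, hc₁⟩ := exists_rewrites_del_append_desc hρ hw
  obtain ⟨b₂, c₂, h₂, hb₂, hc₂⟩ := exists_rewrites_desc_append_del hρ ha hw
  rw [hl _ hdel] at hc₁ hc₂
  rw [hk _ hdel] at hb₂ hc₂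
  have hm' : m = c₁ + c₂ := by linarith
  grw [h₁.weightedDist_le, h₂.weightedDist_le, ← hb₂, hm']
  norm_cast
  linarith

theorem weightedDist_add_le_weightedDist_append_desc_desc_append
    (hρ : ∀ x, a + r ≤ x → ρ x = x) (ha : ∀ y ∈ reducedWords ρ, ∀ p ∈ y, p + 1 ≠ a)
    (hl : ∀ y ∈ reducedWords ρ, y.length = l) (hk : ∀ y ∈ reducedWords ρ, y.countP (a ≤ ·) = k)
    (hm : m + 2 * k = r * l) (hu : u ∈ reducedWords ρ) (hv : v ∈ reducedWords ρ) :
    weightedDist α β u v + (α * k + β * m : ℕ) ≤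
      weightedDist α β (u ++ desc a r) (desc a r ++ v.map (skip a)) := by
  refine le_weightedDist_iff.2 fun b c h => ?_
  have hult := succ_lt_of_mem_reducedWords hρ hu
  obtain ⟨-, -, b', c', h', hb, hc⟩ := h.delRewrites <|
    movesLeft_of_mem_reducedWords_mul_desc hρ (append_desc_mem_reducedWords hρ hu)
  have hcount : u.countP (a + r ≤ ·) = 0 := by
    simpa [List.countP_eq_zero] using fun p hp => (Nat.lt_succ_self p).trans (hult p hp)
  rw [del_append_desc hult, del_desc_append (ha v hv)] at h'
  rw [trace_append_desc hult, trace_desc_append (ha v hv)] at hb hc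
  rw [braidWeight_map_mk, braidWeight_map_mk, hcount, hk v hv, Nat.add_zero] at hb
  rw [commWeight_map_mk, commWeight_map_mk, hcount, hk v hv, hl u hu, hl v hv] at hc
  have hc' : c' + m ≤ c := by linarith
  grw [h'.weightedDist_le, ← hb, ← hc']
  norm_cast
  linarith

theorem extDiam_reducedWords_mul_desc (hρ : ∀ x, a + r ≤ x → ρ x = x)
    (hρ' : (reducedWords ρ).Nonempty) (ha : ∀ y ∈ reducedWords ρ, ∀ p ∈ y, p + 1 ≠ a)
    (hl : ∀ y ∈ reducedWords ρ, y.length = l) (hk : ∀ y ∈ reducedWords ρ, y.countP (a ≤ ·) = k)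
    (hm : m + 2 * k = r * l) :
    extDiam (weightedDist α β) (reducedWords (ρ * wordPerm (desc a r))) =
      extDiam (weightedDist α β) (reducedWords ρ) + (α * k + β * m : ℕ) := by
  have happend {u v u' v' : List ℕ}
      (h : ∀ b c, Rewrites b c u v → Rewrites b c u' v') :
      weightedDist α β u' v' ≤ weightedDist α β u v :=
    le_weightedDist_iff.2 fun b c hbc => (h b c hbc).weightedDist_le
  exact extDiam_eq_add_of_antipodal (weightedDist_comm α β) (weightedDist_triangle α β) hρ'
    (fun _ => del_mem_reducedWords hρ) (fun _ => append_desc_mem_reducedWords hρ)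
    (fun _ => desc_append_mem_reducedWords hρ ha)
    (fun _ _ _ _ => happend fun _ _ h => h.append_right _)
    (fun y hy _ _ => happend fun _ _ h => (h.map_skip (ha y hy)).append_left _)
    (fun _ => weightedDist_append_desc_add_weightedDist_desc_append_le hρ ha hl hk hm)
    (fun _ hu _ hv => weightedDist_add_le_weightedDist_append_desc_desc_append hρ ha hl hk hm hu hv)

end

end

/-! ### The graphs of reduced words -/

section

variable {n : ℕ} {π : Equiv.Perm (Fin n)} {V : Type*} {H : SimpleGraph V}
  {φ : ReducedWord π → V} {α β : ℕ}

theorem IsReducedWord.rewrites {b c : ℕ} {u v : List ℕ} (hu : IsReducedWord π u)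
    (h : Rewrites b c u v) : IsReducedWord π v := by
  rw [isReducedWord_iff] at hu ⊢
  exact ⟨hu.1.rewrites h, h.wordPerm_eq.symm.trans hu.2⟩

theorem Rewrites.edist_le (hα : ∀ u v, LongBraidMove u.1 v.1 → H.edist (φ u) (φ v) ≤ α)
    (hβ : ∀ u v, CommutationMove u.1 v.1 → H.edist (φ u) (φ v) ≤ β) {b c : ℕ} {u v : List ℕ}
    (h : Rewrites b c u v) (hu : IsReducedWord π u) (hv : IsReducedWord π v) :
    H.edist (φ ⟨u, hu⟩) (φ ⟨v, hv⟩) ≤ (α * b + β * c : ℕ) := by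
  induction h with
  | refl => simp
  | @comm b c u v w hm _ ih =>
    have hv' := hu.rewrites (.of_comm hm)
    grw [SimpleGraph.edist_triangle (v := φ ⟨v, hv'⟩), hβ ⟨u, hu⟩ ⟨v, hv'⟩ hm, ih hv' hv]
    norm_cast
    linarith
  | @braid b c u v w hm _ ih =>
    have hv' := hu.rewrites (.of_braid hm)
    grw [SimpleGraph.edist_triangle (v := φ ⟨v, hv'⟩), hα ⟨u, hu⟩ ⟨v, hv'⟩ hm, ih hv' hv]
    norm_cast
    linarith

theorem weightedDist_le_length_walk (hφ : Function.Surjective φ)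
    (hadj : ∀ u v, H.Adj (φ u) (φ v) → weightedDist α β u.1 v.1 ≤ 1)
    (heq : ∀ u v, φ u = φ v → weightedDist α β u.1 v.1 = 0) {x y : V} (p : H.Walk x y)
    {u v : ReducedWord π} (hu : φ u = x) (hv : φ v = y) :
    weightedDist α β u.1 v.1 ≤ p.length := by
  induction p generalizing u with
  | nil => exact (heq u v (hu.trans hv.symm)).le.trans zero_le
  | @cons x y z h p ih =>
    obtain ⟨w, rfl⟩ := hφ y
    subst hu
    grw [weightedDist_triangle α β u.1 w.1 v.1, hadj u w h, ih rfl hv]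
    rw [SimpleGraph.Walk.length_cons]
    push_cast
    rw [add_comm]

theorem edist_eq_weightedDist (hφ : Function.Surjective φ)
    (hα : ∀ u v, LongBraidMove u.1 v.1 → H.edist (φ u) (φ v) ≤ α)
    (hβ : ∀ u v, CommutationMove u.1 v.1 → H.edist (φ u) (φ v) ≤ β)
    (hadj : ∀ u v, H.Adj (φ u) (φ v) → weightedDist α β u.1 v.1 ≤ 1)
    (heq : ∀ u v, φ u = φ v → weightedDist α β u.1 v.1 = 0) (u v : ReducedWord π) :
    H.edist (φ u) (φ v) = weightedDist α β u.1 v.1 :=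
  le_antisymm (le_weightedDist_iff.2 fun _ _ h => h.edist_le hα hβ u.2 v.2) <|
    le_iInf fun p => weightedDist_le_length_walk hφ hadj heq p rfl rfl

theorem finite_reducedWord (π : Equiv.Perm (Fin n)) : Finite (ReducedWord π) := by
  refine ((List.finite_length_eq (Fin n) (length π)).image (List.map Fin.val)).subset fun w hw => ?_
  have hlt : ∀ p ∈ w, p < n := fun p hp => (Nat.lt_succ_self p).trans (hw.1.1 p hp)
  refine ⟨w.pmap Fin.mk hlt, ?_, ?_⟩
  · rw [Set.mem_ofPred_eq, List.length_pmap, IsReducedWord.length_eq hw]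
  · simp [List.map_pmap]

theorem connected_and_diam_eq_extDiam (hφ : Function.Surjective φ)
    (hα : ∀ u v, LongBraidMove u.1 v.1 → H.edist (φ u) (φ v) ≤ α)
    (hβ : ∀ u v, CommutationMove u.1 v.1 → H.edist (φ u) (φ v) ≤ β)
    (hadj : ∀ u v, H.Adj (φ u) (φ v) → weightedDist α β u.1 v.1 ≤ 1)
    (heq : ∀ u v, φ u = φ v → weightedDist α β u.1 v.1 = 0) :
    H.Connected ∧ (H.diam : ℕ∞) = extDiam (weightedDist α β) (reducedWords (toNatPerm π)) := by
  have hmem (u : ReducedWord π) : u.1 ∈ reducedWords (toNatPerm π) := isReducedWord_iff.1 u.2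
  have hedist := edist_eq_weightedDist hφ hα hβ hadj heq
  have : Nonempty V := by
    obtain ⟨w, hw⟩ := nonempty_reducedWords_toNatPerm π
    exact ⟨φ ⟨w, isReducedWord_iff.2 hw⟩⟩
  have : Finite V := have := finite_reducedWord π; .of_surjective φ hφ
  have hconn : H.Connected := by
    refine ⟨fun x y => ?_⟩
    obtain ⟨⟨u, rfl⟩, v, rfl⟩ := And.intro (hφ x) (hφ y)
    obtain ⟨b, c, h⟩ := exists_rewrites (hmem u) (hmem v)
    rw [← SimpleGraph.edist_ne_top_iff_reachable]
    exact ((h.edist_le hα hβ u.2 v.2).trans_lt (ENat.natCast_lt_top _)).ne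
  refine ⟨hconn, ?_⟩
  rw [SimpleGraph.diam, ENat.natCast_toNat (SimpleGraph.connected_iff_ediam_ne_top.1 hconn)]
  apply le_antisymm
  · refine SimpleGraph.ediam_le_of_edist_le fun x y => ?_
    obtain ⟨⟨u, rfl⟩, v, rfl⟩ := And.intro (hφ x) (hφ y)
    exact (hedist u v).trans_le (le_extDiam (hmem u) (hmem v))
  · refine extDiam_le_iff.2 fun u hu v hv => ?_
    rw [← hedist ⟨u, isReducedWord_iff.2 hu⟩ ⟨v, isReducedWord_iff.2 hv⟩]
    exact SimpleGraph.edist_le_ediam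

variable {r s : ReducedWord π → ReducedWord π → Prop} {u v : ReducedWord π}

theorem weightedDist_eq_zero_of_mk_eq (hr : ∀ u v, r u v → weightedDist α β u.1 v.1 = 0)
    (h : Quot.mk r u = Quot.mk r v) : weightedDist α β u.1 v.1 = 0 := by
  replace h := Quot.eqvGen_exact h
  induction h with
  | rel u v h => exact hr u v h
  | refl u => exact weightedDist_self α β u.1
  | symm u v _ ih => rwa [weightedDist_comm]
  | trans u v w _ _ ih ih' =>
    refine le_bot_iff.1 ((weightedDist_triangle α β u.1 v.1 w.1).trans_eq ?_)
    rw [ih, ih', add_zero, bot_eq_zero]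

theorem weightedDist_le_one_of_contraction_adj
    (hr : ∀ u v, r u v → weightedDist α β u.1 v.1 = 0)
    (hs : ∀ u v, s u v → weightedDist α β u.1 v.1 ≤ 1)
    (h : (contraction r s).Adj (Quot.mk r u) (Quot.mk r v)) : weightedDist α β u.1 v.1 ≤ 1 := by
  obtain ⟨-, u', v', hu, hv, h⟩ := h
  have hle : weightedDist α β u'.1 v'.1 ≤ 1 := by
    rcases h with h | h
    · exact hs u' v' h
    · exact weightedDist_comm α β u'.1 v'.1 ▸ hs v' u' h
  grw [weightedDist_triangle α β u.1 u'.1 v.1, weightedDist_triangle α β u'.1 v'.1 v.1, hle]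
  rw [weightedDist_eq_zero_of_mk_eq hr hu.symm, weightedDist_eq_zero_of_mk_eq hr hv, zero_add,
    add_zero]

theorem edist_contraction_le_zero (h : r u v) :
    (contraction r s).edist (Quot.mk r u) (Quot.mk r v) ≤ (0 : ℕ) := by
  simp [Quot.sound h]

theorem edist_contraction_le_one (h : s u v) :
    (contraction r s).edist (Quot.mk r u) (Quot.mk r v) ≤ (1 : ℕ) := by
  refine SimpleGraph.edist_le_one_iff_adj_or_eq.2 ((em _).symm.imp_left fun hne => ?_)
  exact ⟨hne, u, v, rfl, rfl, .inl h⟩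

theorem CommutationMove.weightedDist_le {u v : List ℕ} (h : CommutationMove u v) :
    weightedDist α β u v ≤ β := by
  simpa using (Rewrites.of_comm h).weightedDist_le (α := α) (β := β)

theorem LongBraidMove.weightedDist_le {u v : List ℕ} (h : LongBraidMove u v) :
    weightedDist α β u v ≤ α := by
  simpa using (Rewrites.of_braid h).weightedDist_le (α := α) (β := β)

end

section

variable {n : ℕ} (π : Equiv.Perm (Fin n))

theorem connected_G_and_diam_eq :
    (G π).Connected ∧
      ((G π).diam : ℕ∞) = extDiam (weightedDist 1 1) (reducedWords (toNatPerm π)) := by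
  refine connected_and_diam_eq_extDiam (φ := id) Function.surjective_id (fun u v h => ?_)
    (fun u v h => ?_) (fun u v h => ?_) fun u v h => ?_
  · exact SimpleGraph.edist_le_one_iff_adj_or_eq.2 ((em _).symm.imp_left fun hne => ⟨hne, by tauto⟩)
  · exact SimpleGraph.edist_le_one_iff_adj_or_eq.2 ((em _).symm.imp_left fun hne => ⟨hne, by tauto⟩)
  · obtain ⟨-, h | h | h | h⟩ := h
    · exact h.weightedDist_le
    · exact h.symm.weightedDist_le
    · exact h.weightedDist_le
    · exact h.symm.weightedDist_le
  · rw [show u = v from h, weightedDist_self]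

theorem connected_C_and_diam_eq :
    (C π).Connected ∧
      ((C π).diam : ℕ∞) = extDiam (weightedDist 1 0) (reducedWords (toNatPerm π)) := by
  have hcomm (u v : ReducedWord π) (h : CommutationMove u.1 v.1) :
      weightedDist 1 0 u.1 v.1 = 0 := le_bot_iff.1 h.weightedDist_le
  exact connected_and_diam_eq_extDiam Quot.mk_surjective (fun _ _ h => edist_contraction_le_one h)
    (fun _ _ h => edist_contraction_le_zero h)
    (fun _ _ => weightedDist_le_one_of_contraction_adj hcomm fun _ _ h => h.weightedDist_le)
    fun _ _ => weightedDist_eq_zero_of_mk_eq hcomm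

theorem connected_B_and_diam_eq :
    (B π).Connected ∧
      ((B π).diam : ℕ∞) = extDiam (weightedDist 0 1) (reducedWords (toNatPerm π)) := by
  have hbraid (u v : ReducedWord π) (h : LongBraidMove u.1 v.1) :
      weightedDist 0 1 u.1 v.1 = 0 := le_bot_iff.1 h.weightedDist_le
  exact connected_and_diam_eq_extDiam Quot.mk_surjective (fun _ _ h => edist_contraction_le_zero h)
    (fun _ _ h => edist_contraction_le_one h)
    (fun _ _ => weightedDist_le_one_of_contraction_adj hbraid fun _ _ h => h.weightedDist_le)
    fun _ _ => weightedDist_eq_zero_of_mk_eq hbraid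

end

/-! ### Inflations -/

theorem sizedPerm_ext_iff {p q : SizedPerm} :
    p = q ↔ p.1 = q.1 ∧ toNatPerm p.2 = toNatPerm q.2 := by
  constructor
  · rintro rfl
    exact ⟨rfl, rfl⟩
  · obtain ⟨n, π⟩ := p
    obtain ⟨m, ρ⟩ := q
    rintro ⟨rfl : n = m, h⟩
    exact congrArg _ (toNatPerm_injective h)

theorem sum_castLE {k : ℕ} (f : Fin k → ℕ) (i : Fin k) :
    ∑ l : Fin i, f (Fin.castLE i.2.le l) = ∑ l with l < i, f l := by
  refine Finset.sum_of_injOn (Fin.castLE i.2.le) (Fin.castLE_injective _).injOn ?_ ?_ fun _ _ => rfl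
  · exact fun l _ => Finset.mem_filter.2 ⟨Finset.mem_univ _, l.is_lt⟩
  · exact fun l hl hl' => absurd ⟨⟨l, (Finset.mem_filter.1 hl).2⟩, by simp, rfl⟩ hl'

theorem inflation_finSigmaFinEquiv {k : ℕ} (σ : Equiv.Perm (Fin k)) (p : Fin k → SizedPerm)
    (c : Fin k) (j : Fin (p (σ.symm c)).1) :
    ((inflation σ p).2 (finSigmaFinEquiv (n := fun i => (p i).1) ⟨σ.symm c, j⟩) : ℕ) =
      finSigmaFinEquiv (n := fun c => (p (σ.symm c)).1) ⟨c, (p (σ.symm c)).2 j⟩ := by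
  have hblock : Equiv.sigmaCongrLeft' (β := fun i => Fin (p i).1) σ
      ⟨σ.symm c, (p (σ.symm c)).2 j⟩ = ⟨c, (p (σ.symm c)).2 j⟩ := (Equiv.symm_apply_eq _).2 rfl
  rw [← hblock]
  change (finSigmaFinEquiv (n := fun c => (p (σ.symm c)).1)
    (Equiv.sigmaCongrLeft' (β := fun i => Fin (p i).1) σ
      (Equiv.sigmaCongrRight (fun i => (p i).2)
        ((finSigmaFinEquiv (n := fun i => (p i).1)).symm
          (finSigmaFinEquiv ⟨σ.symm c, j⟩)))) : ℕ) = _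
  rw [Equiv.symm_apply_apply]
  rfl

theorem toNatPerm_inflation_apply {k : ℕ} (σ : Equiv.Perm (Fin k)) (p : Fin k → SizedPerm)
    {i : Fin k} {q : SizedPerm} (hq : p i = q) {j : ℕ} (hj : j < q.1) :
    toNatPerm (inflation σ p).2 (∑ l with l < i, (p l).1 + j) =
      ∑ l with σ l < σ i, (p l).1 + toNatPerm q.2 j := by
  subst hq
  obtain ⟨c, rfl⟩ := σ.symm.surjective i
  have hvalues : ∑ l with σ l < σ (σ.symm c), (p l).1 = ∑ d with d < c, (p (σ.symm d)).1 :=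
    Finset.sum_equiv σ (by simp) (by simp)
  have hblock := inflation_finSigmaFinEquiv σ p c ⟨j, hj⟩
  rw [finSigmaFinEquiv_apply, sum_castLE fun d => (p (σ.symm d)).1] at hblock
  rw [hvalues, toNatPerm_apply _ ⟨j, hj⟩, ← hblock, ← sum_castLE,
    ← finSigmaFinEquiv_apply (n := fun i => (p i).1) ⟨σ.symm c, ⟨j, hj⟩⟩]
  exact toNatPerm_apply (inflation σ p).2 _

section

variable (p q : SizedPerm)

theorem size_inflation_perm12 : (inflation perm12 ![p, q]).1 = p.1 + q.1 :=
  Fin.sum_univ_two fun i => (![p, q] i).1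

theorem size_inflation_perm21 : (inflation perm21 ![p, q]).1 = p.1 + q.1 :=
  Fin.sum_univ_two fun i => (![p, q] i).1

theorem toNatPerm_inflation_perm12 :
    toNatPerm (inflation perm12 ![p, q]).2 = toNatPerm p.2 * shift p.1 (toNatPerm q.2) := by
  ext x
  rw [Equiv.Perm.mul_apply]
  rcases lt_or_ge x p.1 with hx | hx
  · have h := toNatPerm_inflation_apply perm12 ![p, q] (i := 0) (q := p) rfl hx
    rw [shift_of_lt _ hx]
    simpa [perm12] using h
  obtain ⟨x, rfl⟩ := Nat.exists_eq_add_of_le' hx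
  rw [shift_apply_add, toNatPerm_of_le p.2 (Nat.le_add_left _ _)]
  rcases lt_or_ge x q.1 with hx | hx
  · have h := toNatPerm_inflation_apply perm12 ![p, q] (i := 1) (q := q) rfl hx
    simpa [perm12, Finset.sum_filter, Fin.sum_univ_two, add_comm] using h
  · rw [toNatPerm_of_le _ (by rw [size_inflation_perm12]; omega), toNatPerm_of_le _ hx]

theorem toNatPerm_inflation_perm21_single :
    toNatPerm (inflation perm21 ![single, q]).2 = toNatPerm q.2 * wordPerm (desc 0 q.1) := by
  ext x
  rw [Equiv.Perm.mul_apply]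
  obtain _ | x := x
  · have h := toNatPerm_inflation_apply perm21 ![single, q] (i := 0) (q := ⟨1, 1⟩) rfl Nat.one_pos
    rw [wordPerm_desc_self, toNatPerm_of_le q.2 (Nat.le_add_left _ _)]
    simpa [perm21, single, Finset.sum_filter, Fin.sum_univ_two] using h
  rcases lt_or_ge x q.1 with hx | hx
  · have h := toNatPerm_inflation_apply perm21 ![single, q] (i := 1) (q := q) rfl hx
    rw [wordPerm_desc_succ (Nat.zero_le x) (by simpa using hx)]
    simpa [perm21, single, Finset.sum_filter, Fin.sum_univ_two, add_comm] using h
  · have hle : (inflation perm21 ![single, q]).1 ≤ x + 1 := by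
      rw [size_inflation_perm21, Nat.add_comm]
      exact Nat.succ_le_succ hx
    rw [toNatPerm_of_le _ hle,
      wordPerm_of_le (n := q.1 + 1) (by simp [mem_desc]) (by omega), toNatPerm_of_le _ (by omega)]

end

theorem eq_inflation_iff {n a r : ℕ} {π : Equiv.Perm (Fin n)} {π' : Equiv.Perm (Fin a)}
    {π'' : Equiv.Perm (Fin r)} :
    (⟨n, π⟩ : SizedPerm) = inflation perm12 ![⟨a, π'⟩, inflation perm21 ![single, ⟨r, π''⟩]] ↔
      n = a + r + 1 ∧
        toNatPerm π = toNatPerm π' * shift a (toNatPerm π'') * wordPerm (desc a r) := by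
  rw [sizedPerm_ext_iff, toNatPerm_inflation_perm12, toNatPerm_inflation_perm21_single, map_mul,
    ← wordPerm_map_add, map_add_desc, size_inflation_perm12, size_inflation_perm21, mul_assoc,
    Nat.zero_add, Nat.add_comm single.1, ← Nat.add_assoc]
  rfl

/-! ### Avoidance of 231 -/

section

variable {n : ℕ} {π : Equiv.Perm (Fin n)}

theorem Contains.trans {k l : ℕ} {σ : Equiv.Perm (Fin k)} {τ : Equiv.Perm (Fin l)}
    (h : Contains π σ) (h' : Contains σ τ) : Contains π τ := by
  obtain ⟨⟨f, hf⟩, g, hg⟩ := And.intro h h'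
  exact ⟨g.trans f, fun i j => (hf (g i) (g j)).trans (hg i j)⟩

theorem contains_inflation {k : ℕ} (σ : Equiv.Perm (Fin k)) (p : Fin k → SizedPerm) (i : Fin k) :
    Contains (inflation σ p).2 (p i).2 := by
  obtain ⟨c, rfl⟩ := σ.symm.surjective i
  have hmono : StrictMono fun j : Fin (p (σ.symm c)).1 =>
      finSigmaFinEquiv (n := fun i => (p i).1) ⟨σ.symm c, j⟩ := fun j j' h => by
    rw [Fin.lt_def, finSigmaFinEquiv_apply, finSigmaFinEquiv_apply]
    exact Nat.add_lt_add_left h _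
  refine ⟨.ofStrictMono _ hmono, fun j j' => ?_⟩
  have hle := (congrArg₂ (· ≤ ·) (inflation_finSigmaFinEquiv σ p c j)
    (inflation_finSigmaFinEquiv σ p c j')).to_iff
  rw [finSigmaFinEquiv_apply, finSigmaFinEquiv_apply, Nat.add_le_add_iff_left] at hle
  exact hle

theorem Avoids.lt_of_lt_of_lt (h : Avoids π perm231) {i j k : Fin n} (hij : i < j) (hjk : j < k)
    (hlt : π i < π j) : π i < π k := by
  by_contra! hle
  have hmono : StrictMono ![i, j, k] := Fin.strictMono_iff_lt_succ.2 fun l => by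
    fin_cases l
    · exact hij
    · exact hjk
  have hki : π k < π i := hle.lt_of_ne (π.injective.ne (hij.trans hjk).ne')
  refine h ⟨.ofStrictMono _ hmono, fun x y => ?_⟩
  fin_cases x <;> fin_cases y <;>
    simp [perm231, hki, hki.le, hlt, hlt.le, hki.trans hlt, (hki.trans hlt).le]

theorem Avoids.lt_of_lt_max (h : Avoids π perm231) {t i : Fin n} (ht : (π t : ℕ) + 1 = n)
    (hi : i < t) : (π i : ℕ) < t := by
  have hmax : π i < π t := (Fin.le_def.2 (by omega)).lt_of_ne (π.injective.ne hi.ne)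
  have hmaps : Set.MapsTo π (Finset.Ici t) (Finset.Ioi (π i)) := fun k hk => by
    rw [Finset.coe_Ioi, Set.mem_Ioi]
    obtain rfl | hlt := (Finset.mem_Ici.1 hk).eq_or_lt
    · exact hmax
    · exact h.lt_of_lt_of_lt hi hlt hmax
  have hcard := Finset.card_le_card_of_injOn _ hmaps π.injective.injOn
  rw [Fin.card_Ici, Fin.card_Ioi] at hcard
  omega

theorem exists_toNatPerm_eq {f : ℕ → ℕ} (hf : ∀ i < n, f i < n) (hinj : Set.InjOn f (Set.Iio n)) :
    ∃ σ : Equiv.Perm (Fin n), ∀ i < n, toNatPerm σ i = f i := by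
  have hinj' : Function.Injective fun i : Fin n => (⟨f i, hf i i.2⟩ : Fin n) := fun i j h =>
    Fin.ext (hinj i.2 j.2 (congrArg Fin.val h))
  exact ⟨.ofBijective _ (Finite.injective_iff_bijective.1 hinj'),
    fun i hi => toNatPerm_apply _ ⟨i, hi⟩⟩

theorem exists_eq_mul_shift {a r : ℕ} {ρ : Equiv.Perm ℕ} (hρ : ∀ i < a, ρ i < a)
    (hρ' : ∀ i, a + r ≤ i → ρ i = i) :
    ∃ (π' : Equiv.Perm (Fin a)) (π'' : Equiv.Perm (Fin r)),
      ρ = toNatPerm π' * shift a (toNatPerm π'') := by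
  obtain ⟨π', h'⟩ := exists_toNatPerm_eq hρ ρ.injective.injOn
  have hle (j : ℕ) : a ≤ ρ (j + a) := by
    by_contra! hlt
    obtain ⟨i, hi⟩ := π'.surjective ⟨ρ (j + a), hlt⟩
    have hij : ρ i = ρ (j + a) := by rw [← h' i i.2, toNatPerm_apply, hi]
    exact (i.2.trans_le (Nat.le_add_left a j)).ne (ρ.injective hij)
  have hlt (j : ℕ) (hj : j < r) : ρ (j + a) < a + r := by
    by_contra! hle
    have := ρ.injective (hρ' _ hle)
    omega
  obtain ⟨π'', h''⟩ := exists_toNatPerm_eq (n := r) (f := fun j => ρ (j + a) - a)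
    (fun j hj => Nat.sub_lt_left_of_lt_add (hle j) (hlt j hj)) fun i _ j _ hij =>
      Nat.add_right_cancel (ρ.injective (tsub_left_inj (hle i) (hle j) |>.1 hij))
  refine ⟨π', π'', Equiv.ext fun i => ?_⟩
  rw [Equiv.Perm.mul_apply]
  rcases lt_or_ge i a with hi | hi
  · rw [shift_of_lt _ hi, h' i hi]
  obtain ⟨j, rfl⟩ := Nat.exists_eq_add_of_le' hi
  rw [shift_apply_add, toNatPerm_of_le _ (Nat.le_add_left _ _)]
  rcases lt_or_ge j r with hj | hj
  · rw [h'' j hj, Nat.sub_add_cancel (hle j)]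
  · rw [toNatPerm_of_le _ hj, hρ' _ (by omega)]

theorem Avoids.exists_eq_inflation (h : Avoids π perm231) {a r : ℕ} (hn : n = a + r + 1)
    (htop : toNatPerm π a = a + r) :
    ∃ (π' : Equiv.Perm (Fin a)) (π'' : Equiv.Perm (Fin r)), (⟨n, π⟩ : SizedPerm) =
      inflation perm12 ![⟨a, π'⟩, inflation perm21 ![single, ⟨r, π''⟩]] := by
  have ha : a < n := by omega
  let ρ := toNatPerm π * (wordPerm (desc a r))⁻¹
  have hρ {x y : ℕ} (hxy : wordPerm (desc a r) x = y) : ρ y = toNatPerm π x :=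
    hxy ▸ congrArg (toNatPerm π) (Equiv.symm_apply_apply _ x)
  have hlow (i : ℕ) (hi : i < a) : ρ i < a := by
    rw [hρ (wordPerm_desc_of_lt hi), toNatPerm_apply π ⟨i, hi.trans ha⟩]
    refine h.lt_of_lt_max (t := ⟨a, ha⟩) ?_ hi
    rw [← toNatPerm_apply, htop, hn]
  have hhigh (i : ℕ) (hi : a + r ≤ i) : ρ i = i := by
    obtain rfl | hlt := hi.eq_or_lt
    · rw [hρ (wordPerm_desc_self a r), htop]
    · rw [hρ (wordPerm_of_le (n := a + r + 1) (by simp [mem_desc]) hlt),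
        toNatPerm_of_le _ (hn.trans_le hlt)]
  obtain ⟨π', π'', hmul⟩ := exists_eq_mul_shift hlow hhigh
  exact ⟨π', π'', eq_inflation_iff.2 ⟨hn, by rw [← hmul, inv_mul_cancel_right]⟩⟩

theorem Avoids.exists_avoids_eq_inflation {k : ℕ} {σ : Equiv.Perm (Fin k)} (hσ : Avoids π σ)
    (h : Avoids π perm231) {a r : ℕ} (hn : n = a + r + 1) (htop : toNatPerm π a = a + r) :
    ∃ (π' : Equiv.Perm (Fin a)) (π'' : Equiv.Perm (Fin r)), Avoids π' σ ∧ Avoids π'' σ ∧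
      (⟨n, π⟩ : SizedPerm) =
        inflation perm12 ![⟨a, π'⟩, inflation perm21 ![single, ⟨r, π''⟩]] := by
  obtain ⟨π', π'', heq⟩ := h.exists_eq_inflation hn htop
  obtain ⟨rfl, hπ⟩ := Sigma.mk.inj heq
  obtain rfl := eq_of_heq hπ
  let q := inflation perm21 ![single, ⟨r, π''⟩]
  have hq : Contains q.2 π'' := contains_inflation perm21 ![single, ⟨r, π''⟩] 1
  exact ⟨π', π'', fun h' => hσ ((contains_inflation perm12 ![⟨a, π'⟩, q] 0).trans h'),
    fun h' => hσ ((contains_inflation perm12 ![⟨a, π'⟩, q] 1).trans (hq.trans h')), heq⟩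

end

/-! ### The recursion -/

section

variable {a r : ℕ}

theorem exists_extDiam_reducedWords_mul_shift_mul_desc {σ τ : Equiv.Perm ℕ} {x y : List ℕ}
    (hσ : ∀ i, a ≤ i → σ i = i) (hτ : ∀ i, r ≤ i → τ i = i) (hx : x ∈ reducedWords σ)
    (hy : y ∈ reducedWords τ) :
    ∃ m, m + 2 * y.length = r * (x.length + y.length) ∧ ∀ α β : ℕ,
      extDiam (weightedDist α β) (reducedWords (σ * shift a τ * wordPerm (desc a r))) =
        extDiam (weightedDist α β) (reducedWords σ) +
          extDiam (weightedDist α β) (reducedWords τ) +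
          (α * y.length + β * (x.length * y.length + m) : ℕ) := by
  have hfix (i : ℕ) (hi : a + r ≤ i) : (σ * shift a τ) i = i := by
    obtain ⟨j, rfl⟩ := Nat.exists_eq_add_of_le' (le_of_add_le_left hi)
    rw [Equiv.Perm.mul_apply, shift_apply_add, hτ j (by omega), hσ _ (Nat.le_add_left _ _)]
  have hne (w) (hw : w ∈ reducedWords (σ * shift a τ)) : ∀ p ∈ w, p + 1 ≠ a :=
    succ_ne_of_mem_reducedWords_mul_shift hσ hw
  have hcount (w) (hw : w ∈ reducedWords (σ * shift a τ)) : w.countP (a ≤ ·) = y.length := by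
    rw [← length_eq_of_mem_reducedWords (small_big_mem_reducedWords hσ hw).2 hy, big,
      List.length_map, List.countP_eq_length_filter]
  have hlength (w) (hw : w ∈ reducedWords (σ * shift a τ)) : w.length = x.length + y.length := by
    obtain ⟨hs, hb⟩ := small_big_mem_reducedWords hσ hw
    rw [← length_small_add_length_big a w, length_eq_of_mem_reducedWords hs hx,
      length_eq_of_mem_reducedWords hb hy]
  have hmem := append_map_add_mem_reducedWords hσ hx hy
  have hle := two_mul_countP_le hfix hne hmem
  rw [hcount _ hmem, hlength _ hmem] at hle
  obtain ⟨m, hm⟩ := Nat.exists_eq_add_of_le' hle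
  refine ⟨m, hm.symm, fun α β => ?_⟩
  rw [extDiam_reducedWords_mul_desc hfix ⟨_, hmem⟩ hne hlength hcount hm.symm,
    extDiam_reducedWords_mul_shift hσ hx hy, add_assoc, ← Nat.cast_add, mul_add, add_left_comm]

theorem exists_extDiam_reducedWords_of_eq_inflation {n : ℕ} {π : Equiv.Perm (Fin n)}
    {π' : Equiv.Perm (Fin a)} {π'' : Equiv.Perm (Fin r)}
    (h : (⟨n, π⟩ : SizedPerm) =
      inflation perm12 ![⟨a, π'⟩, inflation perm21 ![single, ⟨r, π''⟩]]) :
    ∃ m, m + 2 * length π'' = r * (length π' + length π'') ∧ ∀ α β : ℕ,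
      extDiam (weightedDist α β) (reducedWords (toNatPerm π)) =
        extDiam (weightedDist α β) (reducedWords (toNatPerm π')) +
          extDiam (weightedDist α β) (reducedWords (toNatPerm π'')) +
          (α * length π'' + β * (length π' * length π'' + m) : ℕ) := by
  obtain ⟨x, hx⟩ := nonempty_reducedWords_toNatPerm π'
  obtain ⟨y, hy⟩ := nonempty_reducedWords_toNatPerm π''
  rw [(eq_inflation_iff.1 h).2, (isReducedWord_iff.2 hx).length_eq,
    (isReducedWord_iff.2 hy).length_eq]
  exact exists_extDiam_reducedWords_mul_shift_mul_desc (fun _ => toNatPerm_of_le π')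
    (fun _ => toNatPerm_of_le π'') hx hy

end

end PermGraph


theorem theorem5p4_general {n a r : ℕ} {π : Equiv.Perm (Fin n)} {π' : Equiv.Perm (Fin a)}
    {π'' : Equiv.Perm (Fin r)}
    (h : (⟨n, π⟩ : PermGraph.SizedPerm) =
      PermGraph.inflation PermGraph.perm12
        ![⟨a, π'⟩, PermGraph.inflation PermGraph.perm21 ![PermGraph.single, ⟨r, π''⟩]]) :
    ((PermGraph.G π).Connected ∧ (PermGraph.C π).Connected ∧ (PermGraph.B π).Connected) ∧
    ((PermGraph.G π).diam : ℤ) =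
      (PermGraph.G π').diam + (PermGraph.G π'').diam
        + r * (PermGraph.length π' + PermGraph.length π'')
        + PermGraph.length π'' * ((PermGraph.length π' : ℤ) - 1) ∧
    ((PermGraph.C π).diam : ℤ) =
      (PermGraph.C π').diam + (PermGraph.C π'').diam + PermGraph.length π'' ∧
    ((PermGraph.B π).diam : ℤ) =
      (PermGraph.B π').diam + (PermGraph.B π'').diam
        + r * (PermGraph.length π' + PermGraph.length π'')
        + PermGraph.length π'' * ((PermGraph.length π' : ℤ) - 2) := by
  open PermGraph in
  obtain ⟨m, hm, hdiam⟩ := exists_extDiam_reducedWords_of_eq_inflation h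
  have hG := hdiam 1 1
  have hC := hdiam 1 0
  have hB := hdiam 0 1
  simp only [← (connected_G_and_diam_eq _).2] at hG
  simp only [← (connected_C_and_diam_eq _).2] at hC
  simp only [← (connected_B_and_diam_eq _).2] at hB
  norm_cast at hG hC hB
  zify at hm hG hC hB
  refine ⟨⟨(connected_G_and_diam_eq π).1, (connected_C_and_diam_eq π).1,
    (connected_B_and_diam_eq π).1⟩, ?_, ?_, ?_⟩ <;> linarith

theorem theorem5p4 (n m : ℕ) (hm : 1 ≤ m) (hmn : m ≤ n) (π : Equiv.Perm (Fin n))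
    (hπ : PermGraph.Avoids π PermGraph.perm231)
    (hπm : ((π ⟨m - 1, by omega⟩ : Fin n) : ℕ) + 1 = n) :
    (∃ (π' : Equiv.Perm (Fin (m - 1))) (π'' : Equiv.Perm (Fin (n - m))),
      PermGraph.Avoids π' PermGraph.perm231 ∧ PermGraph.Avoids π'' PermGraph.perm231 ∧
      (⟨n, π⟩ : PermGraph.SizedPerm) =
        PermGraph.inflation PermGraph.perm12
          ![⟨m - 1, π'⟩,
            PermGraph.inflation PermGraph.perm21 ![PermGraph.single, ⟨n - m, π''⟩]]) ∧
    (∀ (π' : Equiv.Perm (Fin (m - 1))) (π'' : Equiv.Perm (Fin (n - m))),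
      (⟨n, π⟩ : PermGraph.SizedPerm) =
        PermGraph.inflation PermGraph.perm12
          ![⟨m - 1, π'⟩,
            PermGraph.inflation PermGraph.perm21 ![PermGraph.single, ⟨n - m, π''⟩]] →
      ((PermGraph.G π).Connected ∧ (PermGraph.C π).Connected ∧ (PermGraph.B π).Connected) ∧
      ((PermGraph.G π).diam : ℤ) =
        (PermGraph.G π').diam + (PermGraph.G π'').diam
          + ((n : ℤ) - m) * (PermGraph.length π' + PermGraph.length π'')
          + PermGraph.length π'' * ((PermGraph.length π' : ℤ) - 1) ∧
      ((PermGraph.C π).diam : ℤ) =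
        (PermGraph.C π').diam + (PermGraph.C π'').diam + PermGraph.length π'' ∧
      ((PermGraph.B π).diam : ℤ) =
        (PermGraph.B π').diam + (PermGraph.B π'').diam
          + ((n : ℤ) - m) * (PermGraph.length π' + PermGraph.length π'')
          + PermGraph.length π'' * ((PermGraph.length π' : ℤ) - 2)) := by
  have htop : PermGraph.toNatPerm π (m - 1) = m - 1 + (n - m) := by
    rw [PermGraph.toNatPerm_apply π ⟨m - 1, by omega⟩]
    omega
  refine ⟨hπ.exists_avoids_eq_inflation hπ (by omega) htop, fun π' π'' h => ?_⟩
  rw [← Nat.cast_sub hmn]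
  exact theorem5p4_general h
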